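/- Let $H$ be a complex Hilbert space with scalar product $\langle\cdot,\cdot\rangle$ (linear in the first argument), and let $A$ be a self-adjoint operator in $H$ with simple discrete spectrum, i.e. every point of $\sigma(A)$ is isolated in $\sigma(A)$ and is an eigenvalue with one-dimensional eigenspace. Let $\sigma(A)=\{\lambda_n\}_{n\in I}$, where $I$ is any index set (for instance $I=\mathbb N$ or $I=\mathbb Z$ with $\lambda_n$ increasing), and suppose that the eigenvalues are separated: there is $d>0$ with $|\lambda_m-\lambda_n|\ge d$ for all $m\ne n$. For each $n\in I$ let $v_n$ be an eigenvector of $A$ for $\lambda_n$ with $\|v_n\|=1$. The Fourier coefficients of $f\in H$ are $\langle f,v_n\rangle$, $n\in I$, and $\ell_1(f)$ denotes the set of all complex sequences of the form $(x_n\langle f,v_n\rangle)_{n\in I}$ with $(x_n)\in\ell_2(I)$. For $\varphi,\psi\in H$ let $$B=A+\langle\cdot,\varphi\rangle\psi,\qquad \operatorname{dom}(B)=\operatorname{dom}(A).$$ The algebraic multiplicity of $z\in\mathbb C$ for $B$ is the dimension of the root subspace $\bigcup_{k\ge 0}\ker (B-z)^k$. We say that $B$ has eigenvalues $\mu_n$,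 $n\in I$, counting with multiplicities, if for every $z\in\mathbb C$ the algebraic multiplicity of $z$ for $B$ equals the number of $n\in I$ with $\mu_n=z$. **(1)** Let $\varphi\in H$ have Fourier coefficients $a_n$, and let $\varepsilon=(\varepsilon_n)_{n\in I}\in\ell_1(\varphi)$. Let $S$ be the set of all $\psi\in H$ for which $B$ has eigenvalues $\lambda_n+\varepsilon_n$, $n\in I$, counting with multiplicities. Then: (a) $S$ is not empty; (b) $S$ consists of exactly one vector if and only if $a_n\ne 0$ for all $n\in I$; (c) for $\psi_0\in S$, a vector $\psi\in H$ belongs to $S$ if and only if $\langle\psi,v_n\rangle=\langle\psi_0,v_n\rangle$ for every $n\in I$ with $a_n\ne0$; thus the coefficients $b_n=\langle\psi,v_n\rangle$ with $a_n=0$ are left undetermined; (d) $S$ is an affine subspace of $H$ whose dimension, in $\{0,1,2,\dots,\infty\}$, is the number of $n\in I$ with $a_n=0$. **(2)** The same holds with the roles of $\varphi$ and $\psi$ interchanged: let $\psi\in H$ have Fourier coefficients $b_n$, let $\varepsilon\in\ell_1(\psi)$, and let $S$ be the set of all $\varphi\in H$ for which $B$ has eigenvalues $\lambda_n+\varepsilon_n$,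 $n\in I$, counting with multiplicities. Then (a)–(d) hold for $S$, with $b_n$ in place of $a_n$ and the vectors $\varphi\in S$ in place of $\psi\in S$. -/

import Mathlib

open Module

namespace RankOnePert

variable {H : Type*} [NormedAddCommGroup H] [InnerProductSpace ℂ H]

/-- The resolvent set of an (unbounded) operator `T`: all `z` such that `T - z` maps the domain of `T`
bijectively onto `H` and has a bounded inverse `R`. -/
def resolventSet (T : H →ₗ.[ℂ] H) : Set ℂ :=
  {z | ∃ R : H →L[ℂ] H,
    (∀ y : H, ∃ x : T.domain, (x : H) = R y ∧ T x - z • (x : H) = y) ∧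
    (∀ x : T.domain, R (T x - z • (x : H)) = x)}

/-- The spectrum of an (unbounded) operator. -/
def spec (T : H →ₗ.[ℂ] H) : Set ℂ := (resolventSet T)ᶜ

/-- All vectors `x` in the domain of `T` with `(T - z) x` in the given subspace `W`. -/
def shiftPreimage (T : H →ₗ.[ℂ] H) (z : ℂ) (W : Submodule ℂ H) : Submodule ℂ H :=
  (W.comap (T.toFun - z • T.domain.subtype)).map T.domain.subtype

theorem mem_shiftPreimage {T : H →ₗ.[ℂ] H} {z : ℂ} {W : Submodule ℂ H} {x : H} :
    x ∈ shiftPreimage T z W ↔ ∃ hx : x ∈ T.domain, T ⟨x, hx⟩ - z • x ∈ W := by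
  simp [shiftPreimage]

/-- The null space of `(T - z) ^ k`, on the natural domain of this power. -/
def kerPow (T : H →ₗ.[ℂ] H) (z : ℂ) : ℕ → Submodule ℂ H
  | 0 => ⊥
  | k + 1 => shiftPreimage T z (kerPow T z k)

/-- The null space of `T - z`. -/
def eigenspace (T : H →ₗ.[ℂ] H) (z : ℂ) : Submodule ℂ H := kerPow T z 1

theorem mem_eigenspace {T : H →ₗ.[ℂ] H} {z : ℂ} {x : H} :
    x ∈ eigenspace T z ↔ ∃ hx : x ∈ T.domain, T ⟨x, hx⟩ = z • x := by
  simp [eigenspace, kerPow, mem_shiftPreimage, sub_eq_zero]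

/-- The root subspace of `T` at `z`: all `x` with `(T - z) ^ k x = 0` for some `k`. -/
def rootSubspace (T : H →ₗ.[ℂ] H) (z : ℂ) : Submodule ℂ H := ⨆ k, kerPow T z k

theorem kerPow_mono (T : H →ₗ.[ℂ] H) (z : ℂ) : Monotone (kerPow T z) := by
  refine monotone_nat_of_le_succ fun k => ?_
  induction k with
  | zero => exact bot_le
  | succ k ih =>
    intro x hx
    obtain ⟨h, h'⟩ := mem_shiftPreimage.1 hx
    exact mem_shiftPreimage.2 ⟨h, ih h'⟩

theorem mem_rootSubspace {T : H →ₗ.[ℂ] H} {z : ℂ} {x : H} :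
    x ∈ rootSubspace T z ↔ ∃ k, x ∈ kerPow T z k :=
  Submodule.mem_iSup_of_directed _ (kerPow_mono T z).directed_le

/-- The algebraic multiplicity of `z` as an eigenvalue of `T`: the dimension of the root subspace
(it is `0` exactly when `z` is not an eigenvalue). -/
noncomputable def algMult (T : H →ₗ.[ℂ] H) (z : ℂ) : ℕ∞ :=
  Cardinal.toENat (Module.rank ℂ (rootSubspace T z))

/-- The eigenvalues of `T`, counted with algebraic multiplicity, are the numbers `μ n`, `n ∈ I`:
every complex number `z` occurs in the family `μ` exactly as often as its algebraic multiplicity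
for `T` says. -/
def HasEigenvalues {I : Type*} (T : H →ₗ.[ℂ] H) (μ : I → ℂ) : Prop :=
  ∀ z : ℂ, algMult T z = {n | μ n = z}.encard

/-- Simple discrete spectrum: each point of the spectrum is isolated in the spectrum and is an
eigenvalue with a one-dimensional eigenspace. -/
def SimpleDiscreteSpectrum (T : H →ₗ.[ℂ] H) : Prop :=
  ∀ z ∈ spec T, (∃ r > 0, ∀ w ∈ spec T, w ≠ z → r ≤ dist w z) ∧ finrank ℂ (eigenspace T z) = 1

/-- The rank-one perturbation `B x = A x + ⟨x, φ⟩ ψ` with domain that of `A`. The scalar product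
`⟨x, φ⟩`, linear in `x`, is `inner ℂ φ x` in Mathlib. -/
noncomputable def perturb (A : H →ₗ.[ℂ] H) (φ ψ : H) : H →ₗ.[ℂ] H where
  domain := A.domain
  toFun := A.toFun + ((innerSL ℂ φ).toLinearMap.smulRight ψ).comp A.domain.subtype

theorem perturb_apply (A : H →ₗ.[ℂ] H) (φ ψ : H) (x : A.domain) :
    perturb A φ ψ x = A x + inner ℂ φ (x : H) • ψ := rfl

/-- The Fourier coefficient `⟨f, v n⟩` of `f`, so that `f = ∑ n, coeff v f n • v n` if `v` is an
orthonormal basis. -/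
noncomputable def coeff {I : Type*} (v : I → H) (f : H) (n : I) : ℂ := inner ℂ (v n) f

/-- The space `ℓ₁(f)` of all sequences `c n = x n * a n` where `x` is square summable and `a` is the
sequence of Fourier coefficients of `f`; as `a` is square summable, such `c` are summable. -/
def ellOne {I : Type*} (v : I → H) (f : H) : Set (I → ℂ) :=
  {c | ∃ x : I → ℂ, Memℓp x 2 ∧ ∀ n, c n = x n * coeff v f n}

end RankOnePert

/-! ### Separated real sequences. -/

namespace RankOnePert

/-! The eigenvalues of `B` depend only on the products `c n = b n * conj (a n)` of the Fourier
coefficients of `ψ` and `φ`, through the perturbation determinant `F w = 1 + ∑ c n / (lam n - w)`.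

The `v n` form a Hilbert basis in which `A` is multiplication by `lam` on its maximal domain
(`exists_isDiagonal`). Solving `(B - z) x = y` coordinatewise then gives an explicit model of the
root subspace, and the algebraic multiplicity of `z` is the order of the zero at `z` of `F`,
multiplied by `w - z` first if `z` is some `lam n` (`algMult_perturb`).

Existence: for summable `ε` the product `∏ (1 + ε n / (lam n - w))` has the zeros `lam n + ε n` in
this sense (`analyticOrderAt_numer_residueSeq`), and it is itself a series of partial fractions,
with coefficients `ε n * ∏_{m ≠ n} (1 + ε m / (lam m - lam n))` (`prodDet_eq_pfrac`).

Uniqueness: two determinants with the same finite orders have an entire quotient. It tends to 1 at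
infinity away from the poles, the maximum principle bounds it near them, and Liouville's theorem
makes it 1, so the coefficients agree (`eq_of_analyticOrderAt_numer_eq`).

Hence the spectral condition says `b n * conj (a n) = ε n * P n` for all `n`, with a bounded
sequence `P` (`hasEigenvalues_perturb_iff`). As `ε n = x n * a n` with `x` square summable, this has
a solution in `ℓ₂`, unique exactly at the indices with `a n ≠ 0`; where `a n = 0` both sides vanish
and `b n` is free. Interchanging `φ` and `ψ` changes only some conjugations. -/

theorem injective_of_separated {I : Type*} {lam : I → ℝ} {d : ℝ} (hd : 0 < d)
    (hsep : ∀ m n, m ≠ n → d ≤ |lam m - lam n|) : Function.Injective lam := by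
  intro m n h
  by_contra hmn
  have := hsep m n hmn
  simp [h] at this
  linarith

/-- Cells of length `d` contain at most one point each, so `n ↦ ⌊(lam n - z) / d⌋` is injective, and
a bounded window meets finitely many cells. -/
theorem finite_abs_sub_le_of_separated {I : Type*} {lam : I → ℝ} {d : ℝ} (hd : 0 < d)
    (hsep : ∀ m n, m ≠ n → d ≤ |lam m - lam n|) (z K : ℝ) :
    {n | |lam n - z| ≤ K}.Finite := by
  have hinj : Function.Injective fun n => ⌊(lam n - z) / d⌋ := by
    intro m n h
    by_contra hmn
    have h1 := Int.abs_sub_lt_one_of_floor_eq_floor h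
    rw [← sub_div, abs_div, abs_of_pos hd, div_lt_one hd] at h1
    have h2 := hsep m n hmn
    rw [show lam m - z - (lam n - z) = lam m - lam n by ring] at h1
    linarith
  refine Set.Finite.of_finite_image (f := fun n => ⌊(lam n - z) / d⌋) ?_ hinj.injOn
  refine (Set.finite_Icc ⌊-K / d⌋ ⌊K / d⌋).subset ?_
  rintro _ ⟨n, hn, rfl⟩
  have hn' := abs_le.1 (show |lam n - z| ≤ K from hn)
  refine ⟨Int.floor_le_floor ?_, Int.floor_le_floor ?_⟩
  · gcongr; exact hn'.1
  · gcongr; exact hn'.2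

theorem exists_forall_ne_of_separated {I : Type*} {lam : I → ℝ} {d : ℝ} (hd : 0 < d)
    (hsep : ∀ m n, m ≠ n → d ≤ |lam m - lam n|) : ∃ z : ℝ, ∀ n, lam n ≠ z := by
  rcases isEmpty_or_nonempty I with h | ⟨⟨k⟩⟩
  · exact ⟨0, fun n => isEmptyElim n⟩
  · refine ⟨lam k + d / 3, fun n hn => ?_⟩
    by_cases hnk : n = k
    · subst hnk; linarith
    · have := hsep n k hnk
      rw [hn, add_sub_cancel_left, abs_of_pos (by linarith)] at this
      linarith

/-- The inverses of separated nonzero reals are isolated from each other. -/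
theorem exists_pos_le_abs_inv_sub_inv {d q : ℝ} (hd : 0 < d) (hq : q ≠ 0) :
    ∃ r > 0, r ≤ |q⁻¹| ∧ ∀ p : ℝ, p ≠ 0 → d ≤ |p - q| → r ≤ |p⁻¹ - q⁻¹| := by
  have hq' : 0 < |q| := abs_pos.2 hq
  refine ⟨d / (|q| * (|q| + d)), by positivity, ?_, fun p hp hpq => ?_⟩
  · rw [abs_inv, div_le_iff₀ (by positivity)]
    field_simp
    linarith
  · have hp' : 0 < |p| := abs_pos.2 hp
    rw [inv_sub_inv hp hq, abs_div, abs_mul, abs_sub_comm q p, div_le_div_iff₀ (by positivity)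
      (by positivity)]
    have h1 : |p| ≤ |p - q| + |q| := by simpa using abs_add_le (p - q) q
    have h2 : 0 ≤ (|p - q| - d) * |q| := by apply mul_nonneg; linarith; positivity
    nlinarith [mul_le_mul_of_nonneg_left h1 (by positivity : 0 ≤ d * |q|)]

variable {H : Type*} [NormedAddCommGroup H] [InnerProductSpace ℂ H]

/-! ### Completeness of the eigenvectors. -/

section SelfAdjoint

variable {A : H →ₗ.[ℂ] H}

theorem inner_apply_of_isSelfAdjoint [CompleteSpace H] (hA : IsSelfAdjoint A) (x y : A.domain) :
    inner ℂ (A x) (y : H) = inner ℂ (x : H) (A y) := by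
  have h := LinearPMap.adjoint_isFormalAdjoint hA.dense_domain
  rw [LinearPMap.isSelfAdjoint_def.1 hA] at h
  exact h x y

theorem orthonormal_of_isSelfAdjoint [CompleteSpace H] (hA : IsSelfAdjoint A) {I : Type*} {lam : I → ℝ}
    (hinj : Function.Injective lam) {v : I → H} (hv : ∀ n, ‖v n‖ = 1)
    (hAv : ∀ n, v n ∈ eigenspace A (lam n)) : Orthonormal ℂ v := by
  refine ⟨hv, fun m n hmn => ?_⟩
  obtain ⟨hm, hm'⟩ := mem_eigenspace.1 (hAv m)
  obtain ⟨hn, hn'⟩ := mem_eigenspace.1 (hAv n)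
  have h := inner_apply_of_isSelfAdjoint hA ⟨v m, hm⟩ ⟨v n, hn⟩
  rw [hm', hn', inner_smul_left, inner_smul_right] at h
  simp only [Complex.conj_ofReal] at h
  have h2 : ((lam m : ℂ) - lam n) * inner ℂ (v m) (v n) = 0 := by rw [sub_mul, h, sub_self]
  refine (mul_eq_zero.1 h2).resolve_left ?_
  exact fun h => hmn (hinj (by exact_mod_cast sub_eq_zero.1 h))

/-- `R` is the inverse of `A - z`. -/
def IsResolvent (A : H →ₗ.[ℂ] H) (z : ℂ) (R : H →L[ℂ] H) : Prop :=
  (∀ y : H, ∃ x : A.domain, (x : H) = R y ∧ A x - z • (x : H) = y) ∧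
    (∀ x : A.domain, R (A x - z • (x : H)) = x)

theorem IsResolvent.mem {z : ℂ} {R : H →L[ℂ] H} (h : IsResolvent A z R) (y : H) :
    ∃ hy : R y ∈ A.domain, A ⟨R y, hy⟩ = y + z • R y := by
  obtain ⟨⟨x, hx⟩, rfl, h2⟩ := h.1 y
  exact ⟨hx, sub_eq_iff_eq_add.1 h2⟩

theorem IsResolvent.apply_eq {z : ℂ} {R : H →L[ℂ] H} (h : IsResolvent A z R) {x y : H}
    (hx : x ∈ A.domain) (hxy : A ⟨x, hx⟩ = y + z • x) : R y = x := by
  have := h.2 ⟨x, hx⟩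
  rwa [hxy, add_sub_cancel_right] at this

theorem IsResolvent.isSelfAdjoint [CompleteSpace H] (hA : IsSelfAdjoint A) {z : ℝ} {R : H →L[ℂ] H}
    (h : IsResolvent A z R) : IsSelfAdjoint R := by
  rw [ContinuousLinearMap.isSelfAdjoint_iff_isSymmetric]
  intro x y
  obtain ⟨hx, hx'⟩ := h.mem x
  obtain ⟨hy, hy'⟩ := h.mem y
  have := inner_apply_of_isSelfAdjoint hA ⟨R x, hx⟩ ⟨R y, hy⟩
  rw [hx', hy', inner_add_left, inner_add_right, inner_smul_left, inner_smul_right,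
    Complex.conj_ofReal] at this
  exact (add_right_cancel this).symm

/-- Formally `t - (A - z)⁻¹ = t (A - z - t⁻¹) (A - z)⁻¹`, whose inverse is `t⁻¹ + t⁻² Q`. The two
auxiliary identities are the resolvent identity for `R` and `Q`. Thus nonzero spectrum of `R` can
only come from spectrum of `A`. -/
theorem IsResolvent.isUnit_algebraMap_sub {z : ℂ} {R : H →L[ℂ] H} (h : IsResolvent A z R)
    {t : ℂ} (ht : t ≠ 0) {Q : H →L[ℂ] H} (hQ : IsResolvent A (z + t⁻¹) Q) :
    IsUnit (algebraMap ℂ (H →L[ℂ] H) t - R) := by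
  have key : ∀ x, R (Q x) = t • (Q x - R x) := fun x => by
    obtain ⟨hx, hx'⟩ := hQ.mem x
    have := h.apply_eq (y := x + t⁻¹ • Q x) hx (by rw [hx', add_smul]; abel)
    rw [map_add, map_smul] at this
    nth_rw 2 [← this]
    rw [add_sub_cancel_left, smul_inv_smul₀ ht]
  have key' : ∀ x, Q (R x) = t • (Q x - R x) := fun x => by
    obtain ⟨hx, hx'⟩ := h.mem x
    have := hQ.apply_eq (y := x - t⁻¹ • R x) hx (by rw [hx', add_smul]; abel)
    rw [map_sub, map_smul] at this
    nth_rw 2 [← this]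
    rw [sub_sub_cancel, smul_inv_smul₀ ht]
  refine ⟨⟨algebraMap ℂ (H →L[ℂ] H) t - R, t⁻¹ • 1 + t⁻¹ • t⁻¹ • Q, ?_, ?_⟩, rfl⟩
  · ext x
    simp only [Algebra.algebraMap_eq_smul_one, mul_apply_eq_comp, sub_apply, smul_apply, add_apply,
      one_apply_eq_self, map_add, map_smul, key]
    match_scalars <;> field_simp <;> ring
  · ext x
    simp only [Algebra.algebraMap_eq_smul_one, mul_apply_eq_comp, sub_apply, smul_apply, add_apply,
      one_apply_eq_self, map_sub, map_smul, key']
    match_scalars <;> field_simp <;> ring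

/-- A self-adjoint operator with separated simple eigenvalues and no other spectrum has a complete
system of eigenvectors. -/
theorem eq_zero_of_forall_inner_eq_zero [CompleteSpace H] (hA : IsSelfAdjoint A)
    (hdisc : SimpleDiscreteSpectrum A) {I : Type*} {lam : I → ℝ}
    (hlam : spec A = Set.range (fun n => (lam n : ℂ))) {d : ℝ} (hd : 0 < d)
    (hsep : ∀ m n, m ≠ n → d ≤ |lam m - lam n|) {v : I → H} (hv : ∀ n, ‖v n‖ = 1)
    (hAv : ∀ n, v n ∈ eigenspace A (lam n)) {x : H} (hx : ∀ n, inner ℂ (v n) x = 0) : x = 0 := by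
  classical
  obtain ⟨z, hz⟩ := exists_forall_ne_of_separated hd hsep
  have hres : ∀ w : ℂ, (∀ n, (lam n : ℂ) ≠ w) → ∃ R, IsResolvent A w R := fun w hw => by
    by_contra hcon
    have : w ∈ spec A := hcon
    rw [hlam] at this
    obtain ⟨n, hn⟩ := this
    exact hw n hn
  obtain ⟨R, hR⟩ := hres z fun n h => hz n (by exact_mod_cast h)
  have hRsa := hR.isSelfAdjoint hA
  set p : I → ℝ := fun n => lam n - z with hp
  have hp0 : ∀ n, p n ≠ 0 := fun n => sub_ne_zero.2 (hz n)
  have hsep' : ∀ m n, m ≠ n → d ≤ |p m - p n| := fun m n h => by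
    simpa [hp] using hsep m n h
  have hspec : ∀ t ∈ spectrum ℝ R, t = 0 ∨ ∃ n, t = (p n)⁻¹ := by
    intro t ht
    by_contra! hcon
    obtain ⟨ht0, htn⟩ := hcon
    have ht0' : (t : ℂ) ≠ 0 := by exact_mod_cast ht0
    obtain ⟨Q, hQ⟩ := hres (z + (t : ℂ)⁻¹) fun n h => by
      refine htn n ?_
      have : p n = t⁻¹ := by
        rw [hp]; simp only
        rw [sub_eq_iff_eq_add']
        exact_mod_cast h
      rw [this, inv_inv]
    have hu := hR.isUnit_algebraMap_sub ht0' hQ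
    refine ht ?_
    rw [spectrum.mem_resolventSet_iff]
    have h3 : algebraMap ℝ (H →L[ℂ] H) t = algebraMap ℂ (H →L[ℂ] H) t := by
      ext y; simp [Algebra.algebraMap_eq_smul_one]
    rwa [h3]
  choose r hr hr0 hrp using fun n => exists_pos_le_abs_inv_sub_inv hd (hp0 n)
  -- A tent function that is 1 at `(p n)⁻¹` and 0 at all other points of `{0} ∪ {(p m)⁻¹}`; on the
  -- spectrum of `R` it acts as the indicator of one point.
  let e : I → ℝ → ℝ := fun n t => max 0 (1 - (r n)⁻¹ * |t - (p n)⁻¹|)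
  have he : ∀ n, Continuous (e n) := fun n => by fun_prop
  have he1 : ∀ n, e n (p n)⁻¹ = 1 := fun n => by simp [e]
  have he_of : ∀ n t, r n ≤ |t - (p n)⁻¹| → e n t = 0 := fun n t h => by
    refine max_eq_left ?_
    rw [sub_nonpos, inv_mul_eq_div, one_le_div (hr n)]
    exact h
  have he0 : ∀ n, e n 0 = 0 := fun n => he_of n 0 (by simpa using hr0 n)
  have hem : ∀ m n, m ≠ n → e n (p m)⁻¹ = 0 := fun m n h =>
    he_of n _ (hrp n (p m) (hp0 m) (hsep' m n h))
  -- `cfc (e n) R` is self-adjoint and maps into the eigenspace of `lam n`, which is the line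
  -- through `v n`; since `x` is orthogonal to `v n`, it is annihilated.
  have hP : ∀ n, cfc (e n) R x = 0 := by
    intro n
    have h1 : R * cfc (e n) R = (p n)⁻¹ • cfc (e n) R := by
      have h0 : R * cfc (e n) R = cfc (fun t : ℝ => t) R * cfc (e n) R := by rw [cfc_id' ℝ R]
      rw [h0, ← cfc_mul (fun t : ℝ => t) (e n) R (by fun_prop) (he n).continuousOn,
        ← cfc_const_mul _ _ R (he n).continuousOn]
      refine cfc_congr fun t ht => ?_
      rcases hspec t ht with rfl | ⟨m, rfl⟩
      · simp [he0]
      · by_cases hmn : m = n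
        · rw [hmn]
        · simp [hem m n hmn]
    have h2 : ∀ y, cfc (e n) R y ∈ eigenspace A (lam n) := by
      intro y
      have h3 : R (cfc (e n) R y) = (p n)⁻¹ • cfc (e n) R y := by
        rw [← mul_apply_eq_comp, h1]; rfl
      obtain ⟨hy, hy'⟩ := hR.mem (p n • cfc (e n) R y)
      have h4 : R (p n • cfc (e n) R y) = cfc (e n) R y := by
        rw [← Complex.coe_smul, map_smul, h3, Complex.coe_smul, smul_inv_smul₀ (hp0 n)]
      simp only [h4] at hy hy'
      refine mem_eigenspace.2 ⟨hy, hy'.trans ?_⟩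
      rw [← Complex.coe_smul, ← add_smul, hp]
      push_cast
      rw [sub_add_cancel]
    have hfin := (hdisc (lam n) (by rw [hlam]; exact ⟨n, rfl⟩)).2
    have hsa : IsSelfAdjoint (cfc (e n) R) := cfc_predicate (e n) R
    have h5 : ∀ y, inner ℂ y (cfc (e n) R x) = 0 := by
      intro y
      have hne : (⟨v n, hAv n⟩ : eigenspace A (lam n)) ≠ 0 := by
        intro h
        have : v n = 0 := congrArg Subtype.val h
        have h6 := hv n
        rw [this, norm_zero] at h6
        exact zero_ne_one h6
      obtain ⟨k, hk⟩ := (finrank_eq_one_iff_of_nonzero' _ hne).1 hfin ⟨_, h2 y⟩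
      have hk' : k • v n = cfc (e n) R y := congrArg Subtype.val hk
      have h6 := (ContinuousLinearMap.isSelfAdjoint_iff_isSymmetric.1 hsa) y x
      change inner ℂ (cfc (e n) R y) x = inner ℂ y (cfc (e n) R x) at h6
      rw [← h6, ← hk', inner_smul_left, hx n, mul_zero]
    exact inner_self_eq_zero.1 (h5 _)
  have hRx : R x = 0 := by
    rw [← norm_le_zero_iff]
    refine le_of_forall_pos_le_add fun η hη => ?_
    set δ : ℝ := η / (‖x‖ + 1) with hδ
    have hδ0 : 0 < δ := by positivity
    -- Outside these finitely many indices `|(p n)⁻¹| < δ`, so subtracting the corresponding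
    -- spectral parts leaves an operator of norm at most `δ` that agrees with `R` at `x`.
    have hfin : {n | |lam n - z| ≤ δ⁻¹}.Finite := finite_abs_sub_le_of_separated hd hsep z δ⁻¹
    set J := hfin.toFinset
    have hcont : Continuous fun t => ∑ n ∈ J, (p n)⁻¹ * e n t :=
      continuous_finsetSum _ fun n _ => (he n).const_mul _
    set T := cfc (fun t : ℝ => t - ∑ n ∈ J, (p n)⁻¹ * e n t) R with hT
    have h1 : T = R - ∑ n ∈ J, (p n)⁻¹ • cfc (e n) R := by
      rw [hT, cfc_sub (fun t : ℝ => t) _ R (by fun_prop) hcont.continuousOn, cfc_id' ℝ R]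
      congr 1
      rw [← Finset.sum_fn, cfc_sum _ R J fun n _ => ((he n).const_mul _).continuousOn]
      exact Finset.sum_congr rfl fun n _ => cfc_const_mul _ _ R (he n).continuousOn
    have h2 : ‖T‖ ≤ δ := by
      refine norm_cfc_le hδ0.le fun t ht => ?_
      rcases hspec t ht with rfl | ⟨m, rfl⟩
      · simp [he0, hδ0.le]
      · by_cases hm : m ∈ J
        · rw [Finset.sum_eq_single_of_mem m hm fun n _ hn => by rw [hem m n hn.symm, mul_zero], he1]
          simp [hδ0.le]
        · rw [Finset.sum_eq_zero fun n hn => by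
            rw [hem m n (fun h => hm (h ▸ hn)), mul_zero]]
          rw [sub_zero, Real.norm_eq_abs, abs_inv]
          have : δ⁻¹ < |p m| := by simpa [J] using hm
          exact (inv_le_comm₀ ((inv_pos.2 hδ0).trans this) hδ0).2 this.le
    have h3 : R x = T x := by
      rw [h1, sub_apply, sum_apply]
      rw [Finset.sum_eq_zero fun n _ => by rw [smul_apply, hP n, smul_zero], sub_zero]
    rw [h3, zero_add]
    calc ‖T x‖ ≤ δ * ‖x‖ := T.le_of_opNorm_le h2 x
      _ ≤ δ * (‖x‖ + 1) := by gcongr; linarith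
      _ = η := by rw [hδ]; field_simp
  obtain ⟨⟨y, hy⟩, hy1, hy2⟩ := hR.1 x
  simp only [hRx] at hy1
  subst hy1
  rw [← hy2]
  have : (⟨0, hy⟩ : A.domain) = 0 := rfl
  rw [this, LinearPMap.map_zero, zero_sub, neg_eq_zero]
  exact smul_zero _

end SelfAdjoint

end RankOnePert

namespace RankOnePert

/-! ### Polynomials under `divX` as a model of Jordan chains. -/

section Algebra

open Polynomial

/-- The polynomials whose coefficients vanish from degree `p` on. -/
def degreeBelow (p : ℕ∞) : Submodule ℂ ℂ[X] where
  carrier := {s | ∀ i : ℕ, p ≤ i → s.coeff i = 0}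
  add_mem' := fun hs ht i hi => by rw [coeff_add, hs i hi, ht i hi, add_zero]
  zero_mem' := fun i _ => coeff_zero i
  smul_mem' := fun a s hs i hi => by rw [coeff_smul, hs i hi, smul_zero]

theorem mem_degreeBelow {p : ℕ∞} {s : ℂ[X]} :
    s ∈ degreeBelow p ↔ ∀ i : ℕ, p ≤ i → s.coeff i = 0 := Iff.rfl

theorem divX_mem_degreeBelow {p : ℕ∞} {s : ℂ[X]} (hs : s ∈ degreeBelow p) :
    divX s ∈ degreeBelow p := fun i hi => by
  rw [coeff_divX]
  exact hs _ (hi.trans (by exact_mod_cast Nat.le_succ i))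

theorem toENat_rank_degreeBelow (p : ℕ∞) :
    Cardinal.toENat (Module.rank ℂ (degreeBelow p)) = p := by
  induction p using ENat.recTopCoe with
  | top =>
    have : degreeBelow ⊤ = ⊤ := by
      rw [eq_top_iff]
      intro s _ i hi
      exact absurd hi (by simp)
    rw [this, rank_top, ← (basisMonomials ℂ).mk_eq_rank'', Cardinal.mk_nat]
    simp
  | coe p =>
    have : degreeBelow p = degreeLT ℂ p := by
      ext s
      rw [mem_degreeLT, degree_lt_iff_coeff_zero, mem_degreeBelow]
      simp
    rw [this, (degreeLTEquiv ℂ p).rank_eq, rank_fin_fun]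
    simp

theorem exists_iterate_divX_eq_zero (s : ℂ[X]) : ∃ k, divX^[k] s = 0 := by
  refine ⟨s.natDegree + 1, ?_⟩
  have h : ∀ k i, (divX^[k] s).coeff i = s.coeff (i + k) := by
    intro k
    induction k with
    | zero => simp
    | succ k ih => intro i; rw [Function.iterate_succ_apply', coeff_divX, ih]; congr 1; ring
  ext i
  rw [h, coeff_zero]
  exact coeff_eq_zero_of_natDegree_lt (by omega)

/-- The pairing of power series and polynomials by their coefficients. -/
noncomputable def pairing (g : PowerSeries ℂ) : ℂ[X] →ₗ[ℂ] ℂ :=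
  Polynomial.lsum fun i => LinearMap.mul ℂ ℂ (PowerSeries.coeff i g)

theorem pairing_apply (g : PowerSeries ℂ) (s : ℂ[X]) :
    pairing g s = ∑ i ∈ s.support, PowerSeries.coeff i g * s.coeff i := by
  simp [pairing, Polynomial.sum_def]

theorem pairing_monomial (g : PowerSeries ℂ) (i : ℕ) (a : ℂ) :
    pairing g (monomial i a) = PowerSeries.coeff i g * a := by
  simp [pairing]

/-- Under the pairing, multiplication of power series by `X` is the transpose of `divX`. -/
theorem pairing_X_mul_sub (f : PowerSeries ℂ) (k : ℂ) (s : ℂ[X]) :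
    pairing (PowerSeries.X * f - PowerSeries.C k) s = pairing f (divX s) - k * s.coeff 0 := by
  induction s using Polynomial.induction_on' with
  | add s t hs ht => rw [map_add, hs, ht, divX_add, map_add, coeff_add]; ring
  | monomial i a =>
    rw [pairing_monomial]
    cases i with
    | zero => simp
    | succ i =>
      have : divX (monomial (i + 1) a) = monomial i a := by
        ext j; simp [coeff_divX, coeff_monomial]
      rw [this, pairing_monomial]
      simp [PowerSeries.coeff_succ_X_mul, coeff_monomial]

theorem pairing_eq_zero {g : PowerSeries ℂ} {s : ℂ[X]} (hs : s ∈ degreeBelow g.order) :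
    pairing g s = 0 := by
  rw [pairing_apply]
  refine Finset.sum_eq_zero fun i _ => ?_
  rcases lt_or_ge (i : ℕ∞) g.order with h | h
  · rw [PowerSeries.coeff_of_lt_order i h, zero_mul]
  · rw [hs i h, mul_zero]

/-- For `g ≠ 0` of order `p`, the polynomial `s` has degree at most `p`, so only the term of index
`p` survives in the pairing; the coefficient of `g` there is nonzero. -/
theorem mem_degreeBelow_of_pairing_eq_zero {g : PowerSeries ℂ} {s : ℂ[X]}
    (hs : divX s ∈ degreeBelow g.order) (h : pairing g s = 0) : s ∈ degreeBelow g.order := by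
  by_cases hg : g = 0
  · rw [hg, PowerSeries.order_zero]
    intro i hi
    exact absurd hi (by simp)
  have hp : g.order = (g.order.toNat : ℕ∞) := (ENat.natCast_toNat (by simpa using hg)).symm
  set p := g.order.toNat
  have hgt : ∀ i, p < i → s.coeff i = 0 := fun i hi => by
    obtain ⟨j, rfl⟩ := Nat.exists_eq_succ_of_ne_zero (by omega : i ≠ 0)
    rw [Nat.succ_eq_add_one, ← coeff_divX]
    refine hs j ?_
    rw [hp]
    exact_mod_cast Nat.lt_succ_iff.1 hi
  have hsum : pairing g s = PowerSeries.coeff p g * s.coeff p := by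
    rw [pairing_apply]
    refine Finset.sum_eq_single p (fun i _ hi => ?_) fun hps => ?_
    · rcases lt_or_gt_of_ne hi with h | h
      · rw [PowerSeries.coeff_of_lt_order i (by rw [hp]; exact_mod_cast h), zero_mul]
      · rw [hgt i h, mul_zero]
    · rw [notMem_support_iff.1 hps, mul_zero]
  have hgp : PowerSeries.coeff p g ≠ 0 := PowerSeries.coeff_order hg
  intro i hi
  rw [hp] at hi
  rcases (show p ≤ i by exact_mod_cast hi).eq_or_lt with rfl | h'
  · exact (mul_eq_zero.1 (hsum ▸ h)).resolve_left hgp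
  · exact hgt i h'

end Algebra

section Model

variable {H : Type*} [NormedAddCommGroup H] [InnerProductSpace ℂ H] {T : H →ₗ.[ℂ] H} {z : ℂ}

/-- The root subspace at `z` is described by a space with a locally nilpotent operator which is
intertwined with `T - z`. -/
theorem algMult_eq_of_model {V : Type*} [AddCommGroup V] [Module ℂ V] (τ : V → V)
    (hτ : ∀ s, ∃ k, τ^[k] s = 0) (X : V →ₗ[ℂ] H)
    (h1 : ∀ s, ∃ hx : X s ∈ T.domain, T ⟨X s, hx⟩ = z • X s + X (τ s))
    (h2 : ∀ s, X s = 0 → τ s = 0 → s = 0)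
    (h3 : ∀ x s, (∃ hx : x ∈ T.domain, T ⟨x, hx⟩ = z • x + X s) → ∃ t, X t = x) :
    algMult T z = Cardinal.toENat (Module.rank ℂ V) := by
  have hX0 : ∀ s, X s = 0 → X (τ s) = 0 := fun s hs => by
    obtain ⟨hx, hx'⟩ := h1 s
    have : (⟨X s, hx⟩ : T.domain) = 0 := Subtype.ext hs
    rw [this, LinearPMap.map_zero, hs, smul_zero, zero_add] at hx'
    exact hx'.symm
  have hinj : Function.Injective X := by
    rw [injective_iff_map_eq_zero]
    intro s hs
    -- The kernel of `X` is stable under `τ`, so local nilpotency reduces injectivity to `h2`.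
    obtain ⟨k, hk⟩ := hτ s
    induction k generalizing s with
    | zero => exact hk
    | succ k ih => exact h2 s hs (ih (τ s) (hX0 s hs) hk)
  have hker : ∀ k s, τ^[k] s = 0 → X s ∈ kerPow T z k := by
    intro k
    induction k with
    | zero =>
      intro s hs
      have : s = 0 := hs
      rw [this, map_zero]
      exact Submodule.zero_mem _
    | succ k ih =>
      intro s hs
      obtain ⟨hx, hx'⟩ := h1 s
      refine mem_shiftPreimage.2 ⟨hx, ?_⟩
      rw [hx', add_sub_cancel_left]
      exact ih _ hs
  have hsurj : ∀ k x, x ∈ kerPow T z k → ∃ s, X s = x := by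
    intro k
    induction k with
    | zero =>
      intro x hx
      have : x = 0 := hx
      exact ⟨0, by rw [map_zero, this]⟩
    | succ k ih =>
      intro x hx
      obtain ⟨hx, hx'⟩ := mem_shiftPreimage.1 hx
      obtain ⟨s, hs⟩ := ih _ hx'
      exact h3 x s ⟨hx, by rw [hs, add_sub_cancel]⟩
  have hrange : LinearMap.range X = rootSubspace T z := by
    ext x
    rw [LinearMap.mem_range, mem_rootSubspace]
    constructor
    · rintro ⟨s, rfl⟩
      obtain ⟨k, hk⟩ := hτ s
      exact ⟨k, hker k s hk⟩
    · rintro ⟨k, hk⟩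
      exact hsurj k x hk
  have h := (LinearEquiv.ofInjective X hinj).lift_rank_eq
  rw [algMult, ← hrange, ← Cardinal.toENat_lift, ← h, Cardinal.toENat_lift]

open Polynomial in
-- The polynomials of degree below `g.order`, with `divX`, form a single Jordan chain of that length
-- (infinite if `g = 0`). The scalar condition `pairing g t = 0` decides whether a chain can be
-- prolonged by one step.
theorem algMult_eq_order_of_model {g : PowerSeries ℂ} (X : ℂ[X] →ₗ[ℂ] H)
    (h1 : ∀ s, pairing g s = 0 →
      ∃ hx : X s ∈ T.domain, T ⟨X s, hx⟩ = z • X s + X (divX s))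
    (h2 : ∀ a, pairing g (C a) = 0 → X (C a) = 0 → a = 0)
    (h3 : ∀ x s, (∃ hx : x ∈ T.domain, T ⟨x, hx⟩ = z • x + X s) →
      ∃ t, divX t = s ∧ pairing g t = 0 ∧ X t = x) :
    algMult T z = g.order := by
  rw [← toENat_rank_degreeBelow g.order]
  refine algMult_eq_of_model (V := degreeBelow g.order)
    (fun s => ⟨divX s.1, divX_mem_degreeBelow s.2⟩) (fun s => ?_)
    (X.comp (degreeBelow g.order).subtype) (fun s => ?_) (fun s hs hs' => ?_) fun x s hx => ?_
  · obtain ⟨k, hk⟩ := exists_iterate_divX_eq_zero s.1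
    refine ⟨k, Subtype.ext ?_⟩
    refine Eq.trans ?_ hk
    exact (Function.Semiconj.iterate_right (f := Subtype.val)
      (ga := fun s : degreeBelow g.order => ⟨divX s.1, divX_mem_degreeBelow s.2⟩) (gb := divX)
      (fun _ => rfl) k).eq s
  · exact h1 s (pairing_eq_zero s.2)
  · have h : divX s.1 = 0 := congrArg Subtype.val hs'
    have h' := divX_mul_X_add s.1
    rw [h, zero_mul, zero_add] at h'
    have h0 : pairing g (C (s.1.coeff 0)) = 0 := by rw [h']; exact pairing_eq_zero s.2
    refine Subtype.ext ?_
    rw [← h', h2 _ h0 (by rw [h']; exact hs), C_0]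
    rfl
  · obtain ⟨t, ht, ht', rfl⟩ := h3 x s hx
    exact ⟨⟨t, mem_degreeBelow_of_pairing_eq_zero (ht ▸ s.2) ht'⟩, rfl⟩

end Model

end RankOnePert

namespace RankOnePert

variable {H : Type*} [NormedAddCommGroup H] [InnerProductSpace ℂ H] {I : Type*}

/-! ### Fourier coefficients and the diagonal form of `A`. -/

section Coeff

theorem coeff_add (v : I → H) (x y : H) (n : I) : coeff v (x + y) n = coeff v x n + coeff v y n :=
  inner_add_right _ _ _

theorem coeff_sub (v : I → H) (x y : H) (n : I) : coeff v (x - y) n = coeff v x n - coeff v y n :=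
  inner_sub_right _ _ _

theorem coeff_neg (v : I → H) (x : H) (n : I) : coeff v (-x) n = -coeff v x n :=
  inner_neg_right _ _

theorem coeff_smul (v : I → H) (a : ℂ) (x : H) (n : I) : coeff v (a • x) n = a * coeff v x n :=
  inner_smul_right _ _ _

theorem coeff_ext (b : HilbertBasis I ℂ H) {x y : H} (h : ∀ n, coeff b x n = coeff b y n) :
    x = y := by
  refine b.repr.injective (lp.ext (funext fun n => ?_))
  rw [b.repr_apply_apply, b.repr_apply_apply]
  exact h n

theorem memℓp_coeff (b : HilbertBasis I ℂ H) (x : H) : Memℓp (coeff b x) 2 := by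
  have : coeff b x = b.repr x := funext fun n => (b.repr_apply_apply x n).symm
  rw [this]
  exact lp.memℓp _

/-- The vector with given Fourier coefficients. -/
noncomputable def ofCoeff (b : HilbertBasis I ℂ H) (y : I → ℂ) (hy : Memℓp y 2) : H :=
  b.repr.symm ⟨y, hy⟩

theorem coeff_ofCoeff (b : HilbertBasis I ℂ H) (y : I → ℂ) (hy : Memℓp y 2) (n : I) :
    coeff b (ofCoeff b y hy) n = y n := by
  rw [coeff, ← b.repr_apply_apply, ofCoeff, LinearIsometryEquiv.apply_symm_apply]

theorem memℓp_mul_of_bounded {g y : I → ℂ} (hg : ∃ C, ∀ n, ‖g n‖ ≤ C) (hy : Memℓp y 2) :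
    Memℓp (fun n => g n * y n) 2 := by
  obtain ⟨C, hC⟩ := hg
  refine Memℓp.mono (hy.norm.const_mul C) fun n => ?_
  rw [norm_mul]
  gcongr
  exact hC n

/-- The operator multiplying the Fourier coefficients by a bounded sequence. -/
noncomputable def diagOp (b : HilbertBasis I ℂ H) (g : I → ℂ) (hg : ∃ C, ∀ n, ‖g n‖ ≤ C) :
    Module.End ℂ H where
  toFun x := ofCoeff b _ (memℓp_mul_of_bounded hg (memℓp_coeff b x))
  map_add' x y := coeff_ext b fun n => by
    simp only [coeff_ofCoeff, coeff_add]; ring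
  map_smul' a x := coeff_ext b fun n => by
    simp only [coeff_ofCoeff, coeff_smul, RingHom.id_apply]; ring

theorem coeff_diagOp (b : HilbertBasis I ℂ H) (g : I → ℂ) (hg : ∃ C, ∀ n, ‖g n‖ ≤ C) (x : H)
    (n : I) : coeff b (diagOp b g hg x) n = g n * coeff b x n :=
  coeff_ofCoeff _ _ _ _

theorem coeff_diagOp_pow (b : HilbertBasis I ℂ H) (g : I → ℂ) (hg : ∃ C, ∀ n, ‖g n‖ ≤ C) (i : ℕ)
    (x : H) (n : I) : coeff b ((diagOp b g hg ^ i) x) n = g n ^ i * coeff b x n := by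
  induction i with
  | zero => simp
  | succ i ih => rw [pow_succ', Module.End.mul_apply, coeff_diagOp, ih, pow_succ', mul_assoc]

end Coeff

/-- Only finitely many `lam n` are within distance 1 of `z.re`. The bound holds even for `z = lam
m`, because `0⁻¹ = 0`; the resulting diagonal operator is then the reduced resolvent. -/
theorem exists_norm_inv_sub_le {lam : I → ℝ} {d : ℝ} (hd : 0 < d)
    (hsep : ∀ m n, m ≠ n → d ≤ |lam m - lam n|) (z : ℂ) :
    ∃ C, ∀ n, ‖((lam n : ℂ) - z)⁻¹‖ ≤ C := by
  have hfin := finite_abs_sub_le_of_separated hd hsep z.re 1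
  refine ⟨1 + ∑ n ∈ hfin.toFinset, ‖((lam n : ℂ) - z)⁻¹‖, fun n => ?_⟩
  by_cases hn : n ∈ hfin.toFinset
  · have := Finset.single_le_sum (f := fun n => ‖((lam n : ℂ) - z)⁻¹‖)
      (fun i _ => norm_nonneg _) hn
    linarith
  · have h1 : 1 < |lam n - z.re| := by simpa using hn
    have h2 : |lam n - z.re| ≤ ‖(lam n : ℂ) - z‖ := by
      simpa using Complex.abs_re_le_norm ((lam n : ℂ) - z)
    have h3 : ‖((lam n : ℂ) - z)⁻¹‖ ≤ 1 := by
      rw [norm_inv]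
      exact inv_le_one_of_one_le₀ (by linarith)
    have : 0 ≤ ∑ n ∈ hfin.toFinset, ‖((lam n : ℂ) - z)⁻¹‖ :=
      Finset.sum_nonneg fun i _ => norm_nonneg _
    linarith

/-- `A` acts as multiplication by `lam` on the Fourier coefficients, on its maximal domain. -/
structure IsDiagonal (A : H →ₗ.[ℂ] H) (b : HilbertBasis I ℂ H) (lam : I → ℝ) : Prop where
  coeff_apply : ∀ (x : A.domain) (n : I), coeff b (A x) n = lam n * coeff b x n
  exists_apply_eq : ∀ x y : H, (∀ n, coeff b y n = lam n * coeff b x n) →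
    ∃ hx : x ∈ A.domain, A ⟨x, hx⟩ = y

theorem exists_isDiagonal [CompleteSpace H] {A : H →ₗ.[ℂ] H} (hA : IsSelfAdjoint A)
    (hdisc : SimpleDiscreteSpectrum A) {lam : I → ℝ}
    (hlam : spec A = Set.range (fun n => (lam n : ℂ))) {d : ℝ} (hd : 0 < d)
    (hsep : ∀ m n, m ≠ n → d ≤ |lam m - lam n|) {v : I → H} (hv : ∀ n, ‖v n‖ = 1)
    (hAv : ∀ n, v n ∈ eigenspace A (lam n)) :
    ∃ b : HilbertBasis I ℂ H, ⇑b = v ∧ IsDiagonal A b lam := by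
  have hon := orthonormal_of_isSelfAdjoint hA (injective_of_separated hd hsep) hv hAv
  have hbot : (Submodule.span ℂ (Set.range v))ᗮ = ⊥ := by
    rw [Submodule.eq_bot_iff]
    intro x hx
    refine eq_zero_of_forall_inner_eq_zero hA hdisc hlam hd hsep hv hAv fun n => ?_
    exact (Submodule.mem_orthogonal _ _).1 hx _ (Submodule.subset_span ⟨n, rfl⟩)
  let b := HilbertBasis.mkOfOrthogonalEqBot hon hbot
  have hb : ⇑b = v := HilbertBasis.coe_mkOfOrthogonalEqBot hon hbot
  have hcoeff : ∀ (x : A.domain) (n : I), coeff b (A x) n = lam n * coeff b x n := by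
    intro x n
    obtain ⟨hn, hn'⟩ := mem_eigenspace.1 (hAv n)
    have := inner_apply_of_isSelfAdjoint hA ⟨v n, hn⟩ x
    rw [hn', inner_smul_left, Complex.conj_ofReal] at this
    rw [coeff, coeff, hb, this]
  refine ⟨b, hb, hcoeff, fun x y hxy => ?_⟩
  obtain ⟨z, hz⟩ := exists_forall_ne_of_separated hd hsep
  have hzs : (z : ℂ) ∈ resolventSet A := by
    by_contra hcon
    have : (z : ℂ) ∈ spec A := hcon
    rw [hlam] at this
    obtain ⟨n, hn⟩ := this
    exact hz n (by simpa using hn)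
  obtain ⟨R, hR, -⟩ := hzs
  obtain ⟨x', -, hx'⟩ := hR (y - (z : ℂ) • x)
  -- Maximality of the domain: the solution `x'` of `(A - z) x' = y - z x` has the coefficients of
  -- `x`, since `lam n - z ≠ 0`.
  have hxx : (x' : H) = x := coeff_ext b fun n => by
    have h := congrArg (coeff b · n) hx'
    simp only [coeff_sub, coeff_smul, hcoeff, hxy] at h
    have h0 : ((lam n : ℂ) - z) ≠ 0 := sub_ne_zero.2 (by exact_mod_cast hz n)
    exact mul_left_cancel₀ h0 (by rw [sub_mul, sub_mul]; exact h)
  obtain ⟨x', hx''⟩ := x'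
  simp only at hxx
  subst hxx
  exact ⟨hx'', sub_left_injective hx'⟩

/-- Because the domain of `A` is maximal, the scalar equations already force `x` into it. -/
theorem exists_perturb_apply_eq_iff {A : H →ₗ.[ℂ] H} {b : HilbertBasis I ℂ H} {lam : I → ℝ}
    (hA : IsDiagonal A b lam) (φ ψ x y : H) (z : ℂ) :
    (∃ hx : x ∈ (perturb A φ ψ).domain, perturb A φ ψ ⟨x, hx⟩ = z • x + y) ↔
      ∀ n, (lam n - z) * coeff b x n + inner ℂ φ x * coeff b ψ n = coeff b y n := by
  constructor
  · rintro ⟨hx, h⟩ n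
    have hx' : x ∈ A.domain := hx
    have h' : A ⟨x, hx'⟩ + inner ℂ φ x • ψ = z • x + y := h
    have h2 := congrArg (coeff b · n) h'
    simp only [coeff_add, coeff_smul, hA.coeff_apply] at h2
    linear_combination h2
  · intro h
    obtain ⟨hx, hx'⟩ := hA.exists_apply_eq x (z • x + y - inner ℂ φ x • ψ) fun n => by
      simp only [coeff_sub, coeff_add, coeff_smul, ← h n]
      ring
    refine ⟨hx, ?_⟩
    change A ⟨x, hx⟩ + inner ℂ φ x • ψ = z • x + y
    rw [hx', sub_add_cancel]

/-- The product sequence `⟨ψ, v n⟩ ⟨v n, φ⟩`, which determines the eigenvalues of the perturbed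
operator. -/
noncomputable def coeffProd (v : I → H) (φ ψ : H) (n : I) : ℂ := coeff v ψ n * inner ℂ φ (v n)

theorem hasSum_coeffProd (b : HilbertBasis I ℂ H) (φ ψ : H) :
    HasSum (coeffProd b φ ψ) (inner ℂ φ ψ) := by
  have : coeffProd b φ ψ = fun n => inner ℂ φ (b n) * inner ℂ (b n) ψ :=
    funext fun n => mul_comm _ _
  rw [this]
  exact b.hasSum_inner_mul_inner φ ψ

/-- The Taylor series at `z` of `w ↦ 1 + ∑ c n / (lam n - w)`, without the term with a pole at `z`
(if there is one). -/
noncomputable def regSeries (lam : I → ℝ) (c : I → ℂ) (z : ℂ) : PowerSeries ℂ :=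
  PowerSeries.mk fun i => (if i = 0 then 1 else 0) + ∑' n, c n * (((lam n : ℂ) - z)⁻¹) ^ (i + 1)

/-! ### Root subspaces of the perturbed operator. -/

section Multiplicity

open Polynomial

theorem divX_X_mul_add_C (s : ℂ[X]) (a : ℂ) : divX (Polynomial.X * s + C a) = s := by
  rw [divX_add, divX_C, add_zero]
  ext i
  simp [coeff_divX]

theorem coeff_zero_X_mul_add_C (s : ℂ[X]) (a : ℂ) : (Polynomial.X * s + C a).coeff 0 = a := by
  simp

/-- `Polynomial.divX` as a linear map. -/
noncomputable def divXLinear : ℂ[X] →ₗ[ℂ] ℂ[X] where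
  toFun := divX
  map_add' _ _ := divX_add
  map_smul' a s := by rw [smul_eq_C_mul, divX_C_mul, smul_eq_C_mul, RingHom.id_apply]

variable {A : H →ₗ.[ℂ] H} {b : HilbertBasis I ℂ H} {lam : I → ℝ} {z : ℂ}

/-- The linear combinations of the vectors `D ψ, D² ψ, …`, where `D` is the reduced resolvent. -/
noncomputable def chainMap (b : HilbertBasis I ℂ H) (lam : I → ℝ) (z : ℂ)
    (hz : ∃ C, ∀ n, ‖((lam n : ℂ) - z)⁻¹‖ ≤ C) (ψ : H) : ℂ[X] →ₗ[ℂ] H :=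
  (LinearMap.applyₗ (diagOp b _ hz ψ)).comp (aeval (diagOp b _ hz)).toLinearMap

variable (hz : ∃ C, ∀ n, ‖((lam n : ℂ) - z)⁻¹‖ ≤ C)

theorem coeff_chainMap (ψ : H) (s : ℂ[X]) (n : I) :
    coeff b (chainMap b lam z hz ψ s) n = ((lam n : ℂ) - z)⁻¹ *
      (coeff b (chainMap b lam z hz ψ (divX s)) n + s.coeff 0 * coeff b ψ n) := by
  conv_lhs => rw [← X_mul_divX_add s]
  rw [map_add, coeff_add]
  simp only [chainMap, LinearMap.comp_apply, AlgHom.toLinearMap_apply, map_mul, aeval_X, aeval_C,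
    LinearMap.applyₗ_apply_apply, Module.End.mul_apply, coeff_diagOp, Module.algebraMap_end_apply,
    coeff_smul]
  ring

theorem coeff_chainMap_of_eq {m : I} (hm : (lam m : ℂ) = z) (ψ : H) (s : ℂ[X]) :
    coeff b (chainMap b lam z hz ψ s) m = 0 := by
  rw [coeff_chainMap, hm, sub_self, inv_zero, zero_mul]

/-- With `D` the reduced resolvent, the coefficient of index `i` of `regSeries` is `⟨D ^ (i + 1) ψ,
φ⟩`, plus 1 for `i = 0`. This links the determinant to the chain vectors. -/
theorem pairing_regSeries (φ ψ : H) (s : ℂ[X]) :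
    pairing (regSeries lam (coeffProd b φ ψ) z) s =
      s.coeff 0 + inner ℂ φ (chainMap b lam z hz ψ s) := by
  induction s using Polynomial.induction_on' with
  | add s t hs ht =>
    rw [map_add, hs, ht, map_add, inner_add_right, Polynomial.coeff_add]; ring
  | monomial i a =>
    rw [pairing_monomial, regSeries, PowerSeries.coeff_mk]
    have h : chainMap b lam z hz ψ (monomial i a) = a • (diagOp b _ hz ^ (i + 1)) ψ := by
      simp [chainMap, aeval_monomial, pow_succ]
    have h2 : ∑' n, coeffProd b φ ψ n * (((lam n : ℂ) - z)⁻¹) ^ (i + 1) =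
        inner ℂ φ ((diagOp b _ hz ^ (i + 1)) ψ) := by
      rw [← (hasSum_coeffProd b φ _).tsum_eq]
      refine tsum_congr fun n => ?_
      rw [coeffProd, coeffProd, coeff_diagOp_pow]
      ring
    rw [h, inner_smul_right, h2, coeff_monomial]
    split_ifs <;> ring

theorem inner_chainMap (φ ψ : H) (s : ℂ[X]) :
    inner ℂ φ (chainMap b lam z hz ψ s) =
      pairing (regSeries lam (coeffProd b φ ψ) z) s - s.coeff 0 := by
  rw [pairing_regSeries hz]; ring

/-- The algebraic multiplicity at a point which is not an eigenvalue of `A`. -/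
theorem algMult_perturb_of_forall_ne (hA : IsDiagonal A b lam)
    (hz : ∃ C, ∀ n, ‖((lam n : ℂ) - z)⁻¹‖ ≤ C) (hne : ∀ n, (lam n : ℂ) ≠ z) (φ ψ : H) :
    algMult (perturb A φ ψ) z = (regSeries lam (coeffProd b φ ψ) z).order := by
  have hne' : ∀ n, (lam n : ℂ) - z ≠ 0 := fun n => sub_ne_zero.2 (hne n)
  -- Solving `(A - z) x + ⟨x, φ⟩ ψ = y` gives `x = D y - ⟨x, φ⟩ D ψ`. So a chain polynomial `s` is
  -- prolonged to `X * s + ⟨x, φ⟩`, and the vanishing pairing expresses that the constant term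
  -- really is `⟨x, φ⟩`.
  refine algMult_eq_order_of_model (-chainMap b lam z hz ψ) (fun s hs => ?_) (fun a ha ha' => ?_)
    fun x s hx => ?_
  · rw [exists_perturb_apply_eq_iff hA]
    intro n
    simp only [LinearMap.neg_apply, inner_neg_right, inner_chainMap, coeff_neg, hs]
    rw [coeff_chainMap]
    have := hne' n
    field_simp
    ring
  · rw [LinearMap.neg_apply, neg_eq_zero] at ha'
    have := inner_chainMap (b := b) hz φ ψ (C a)
    rw [ha', inner_zero_right, ha] at this
    simpa using this.symm
  · rw [exists_perturb_apply_eq_iff hA] at hx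
    refine ⟨Polynomial.X * s + C (inner ℂ φ x), ?_⟩
    have h1 := divX_X_mul_add_C s (inner ℂ φ x)
    have h2 := coeff_zero_X_mul_add_C s (inner ℂ φ x)
    have h3 : (-chainMap b lam z hz ψ) (Polynomial.X * s + C (inner ℂ φ x)) = x := by
      refine coeff_ext b fun n => ?_
      rw [LinearMap.neg_apply, coeff_neg, coeff_chainMap, h1, h2]
      have h4 := hx n
      rw [LinearMap.neg_apply, coeff_neg] at h4
      have := hne' n
      field_simp
      linear_combination -h4
    refine ⟨h1, ?_, h3⟩
    rw [pairing_regSeries hz, h2]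
    nth_rw 1 [← h3]
    rw [LinearMap.neg_apply, inner_neg_right, neg_add_cancel]

theorem coeff_basis_of_ne (b : HilbertBasis I ℂ H) {m n : I} (h : n ≠ m) :
    coeff b (b m) n = 0 := b.orthonormal.2 h

theorem coeff_basis_self (b : HilbertBasis I ℂ H) (m : I) : coeff b (b m) m = 1 := by
  rw [coeff, inner_self_eq_norm_sq_to_K, b.orthonormal.1 m]
  simp

/-- The reduced resolvent determines every component of `x` except the one along `b m`. Taking the
scalar product of the first identity with `φ` yields the second. -/
theorem eq_smul_sub_chainMap {m : I} (hm : (lam m : ℂ) = z) (hne : ∀ n, n ≠ m → (lam n : ℂ) ≠ z)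
    (φ ψ x : H) (s : ℂ[X])
    (h : ∀ n, n ≠ m → (lam n - z) * coeff b x n + inner ℂ φ x * coeff b ψ n =
      -coeff b (chainMap b lam z hz ψ s) n) :
    x = coeff b x m • b m - chainMap b lam z hz ψ (Polynomial.X * s + C (inner ℂ φ x)) ∧
      pairing (regSeries lam (coeffProd b φ ψ) z) (Polynomial.X * s + C (inner ℂ φ x)) =
        coeff b x m * inner ℂ φ (b m) := by
  have h1 : x = coeff b x m • b m -
      chainMap b lam z hz ψ (Polynomial.X * s + C (inner ℂ φ x)) := by
    refine coeff_ext b fun n => ?_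
    rw [coeff_sub, coeff_smul]
    by_cases hn : n = m
    · rw [hn, coeff_basis_self, coeff_chainMap_of_eq hz hm, sub_zero, mul_one]
    · rw [coeff_basis_of_ne b hn, coeff_chainMap, divX_X_mul_add_C, coeff_zero_X_mul_add_C]
      have h2 := h n hn
      have h3 : (lam n : ℂ) - z ≠ 0 := sub_ne_zero.2 (hne n hn)
      field_simp
      linear_combination h2
  refine ⟨h1, ?_⟩
  have h2 := congrArg (inner ℂ φ) h1
  rw [inner_sub_right, inner_smul_right, inner_chainMap, coeff_zero_X_mul_add_C] at h2
  linear_combination h2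

/-- The component along `b m` can be adjusted so that `⟨X s, φ⟩` is the constant term of `s`. The
remaining equation, at index `m`, is the vanishing of the pairing with the asserted series. -/
theorem algMult_perturb_of_inner_ne_zero (hA : IsDiagonal A b lam)
    (hz : ∃ C, ∀ n, ‖((lam n : ℂ) - z)⁻¹‖ ≤ C) {m : I} (hm : (lam m : ℂ) = z)
    (hne : ∀ n, n ≠ m → (lam n : ℂ) ≠ z) (φ ψ : H) (ha : inner ℂ φ (b m) ≠ 0) :
    algMult (perturb A φ ψ) z = (PowerSeries.X * regSeries lam (coeffProd b φ ψ) z -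
      PowerSeries.C (coeffProd b φ ψ m)).order := by
  set f := regSeries lam (coeffProd b φ ψ) z with hf
  let X : ℂ[X] →ₗ[ℂ] H := ((inner ℂ φ (b m))⁻¹ • pairing f).smulRight (b m) -
    chainMap b lam z hz ψ
  have hX : ∀ s, X s = ((inner ℂ φ (b m))⁻¹ * pairing f s) • b m - chainMap b lam z hz ψ s :=
    fun s => rfl
  have hφX : ∀ s, inner ℂ φ (X s) = s.coeff 0 := fun s => by
    rw [hX, inner_sub_right, inner_smul_right, inner_chainMap, ← hf]
    field_simp
    ring
  refine algMult_eq_order_of_model X (fun s hs => ?_) (fun a _ ha' => ?_) fun x s hx => ?_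
  · rw [exists_perturb_apply_eq_iff hA]
    rw [pairing_X_mul_sub, coeffProd] at hs
    intro n
    rw [hφX, hX, hX, coeff_sub, coeff_sub, coeff_smul, coeff_smul]
    by_cases hn : n = m
    · rw [hn, hm, coeff_chainMap_of_eq hz hm, coeff_chainMap_of_eq hz hm, coeff_basis_self]
      field_simp
      linear_combination -hs
    · have h3 : (lam n : ℂ) - z ≠ 0 := sub_ne_zero.2 (hne n hn)
      rw [coeff_basis_of_ne b hn, coeff_chainMap _ _ s]
      field_simp
      ring
  · have := hφX (C a)
    rw [ha', inner_zero_right, coeff_C_zero] at this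
    exact this.symm
  · rw [exists_perturb_apply_eq_iff hA] at hx
    obtain ⟨h1, h2⟩ := eq_smul_sub_chainMap hz hm hne φ ψ x s fun n hn => by
      rw [hx n, hX, coeff_sub, coeff_smul, coeff_basis_of_ne b hn]; ring
    refine ⟨_, divX_X_mul_add_C s (inner ℂ φ x), ?_, ?_⟩
    · have h3 := hx m
      rw [hX, coeff_sub, coeff_smul, coeff_basis_self, coeff_chainMap_of_eq hz hm, hm] at h3
      rw [pairing_X_mul_sub, divX_X_mul_add_C, coeff_zero_X_mul_add_C, coeffProd]
      field_simp at h3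
      linear_combination -h3
    · rw [hX, hf, h2, mul_comm (coeff b x m), inv_mul_cancel_left₀ ha]
      exact h1.symm

/-- Here `b m` is an eigenvector of the perturbed operator and starts the chain. The equation at
index `m` fixes `⟨x, φ⟩` by the constant term, hence the shift by `divX` and the extra factor `X`.
-/
theorem algMult_perturb_of_coeff_ne_zero (hA : IsDiagonal A b lam)
    (hz : ∃ C, ∀ n, ‖((lam n : ℂ) - z)⁻¹‖ ≤ C) {m : I} (hm : (lam m : ℂ) = z)
    (hne : ∀ n, n ≠ m → (lam n : ℂ) ≠ z) (φ ψ : H) (ha : inner ℂ φ (b m) = 0)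
    (hb : coeff b ψ m ≠ 0) :
    algMult (perturb A φ ψ) z = (PowerSeries.X * regSeries lam (coeffProd b φ ψ) z -
      PowerSeries.C (coeffProd b φ ψ m)).order := by
  set f := regSeries lam (coeffProd b φ ψ) z with hf
  let X : ℂ[X] →ₗ[ℂ] H := (lcoeff ℂ 0).smulRight (b m) -
    (coeff b ψ m)⁻¹ • (chainMap b lam z hz ψ).comp divXLinear
  have hX : ∀ s, X s = s.coeff 0 • b m - (coeff b ψ m)⁻¹ • chainMap b lam z hz ψ (divX s) :=
    fun s => rfl
  have hpair : ∀ s, pairing (PowerSeries.X * f - PowerSeries.C (coeffProd b φ ψ m)) s =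
      pairing f (divX s) := fun s => by
    rw [pairing_X_mul_sub, coeffProd, ha, mul_zero, zero_mul, sub_zero]
  refine algMult_eq_order_of_model X (fun s hs => ?_) (fun a _ ha' => ?_) fun x s hx => ?_
  · rw [hpair] at hs
    rw [exists_perturb_apply_eq_iff hA]
    intro n
    rw [hX, hX, inner_sub_right, inner_smul_right, inner_smul_right, ha, inner_chainMap, ← hf, hs,
      coeff_sub, coeff_sub, coeff_smul, coeff_smul, coeff_smul, coeff_smul]
    by_cases hn : n = m
    · rw [hn, hm, coeff_chainMap_of_eq hz hm, coeff_chainMap_of_eq hz hm, coeff_basis_self]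
      field_simp
      ring
    · have h3 : (lam n : ℂ) - z ≠ 0 := sub_ne_zero.2 (hne n hn)
      rw [coeff_basis_of_ne b hn, coeff_chainMap _ _ (divX s)]
      field_simp
      ring
  · have := congrArg (coeff b · m) ha'
    simp only [hX, coeff_C_zero, coeff_sub, coeff_smul, coeff_chainMap_of_eq hz hm,
      coeff_basis_self] at this
    simpa [coeff] using this
  · rw [exists_perturb_apply_eq_iff hA] at hx
    have hσ : inner ℂ φ x = (coeff b ψ m)⁻¹ * s.coeff 0 := by
      have h3 := hx m
      rw [hX, coeff_sub, coeff_smul, coeff_smul, coeff_basis_self, coeff_chainMap_of_eq hz hm,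
        hm] at h3
      field_simp
      linear_combination h3
    have hs : Polynomial.X * ((coeff b ψ m)⁻¹ • divX s) + C (inner ℂ φ x) =
        (coeff b ψ m)⁻¹ • s := by
      conv_rhs => rw [← X_mul_divX_add s]
      rw [hσ, smul_add, mul_smul_comm, smul_C, smul_eq_mul]
    obtain ⟨h1, h2⟩ := eq_smul_sub_chainMap hz hm hne φ ψ x ((coeff b ψ m)⁻¹ • divX s)
      fun n hn => by
        rw [hx n, hX, coeff_sub, coeff_smul, coeff_basis_of_ne b hn, map_smul]; ring
    rw [hs, map_smul] at h1 h2
    rw [ha, mul_zero] at h2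
    refine ⟨_, divX_X_mul_add_C s (coeff b x m), ?_, ?_⟩
    · rw [hpair, divX_X_mul_add_C]
      exact (mul_eq_zero.1 h2).resolve_left (inv_ne_zero hb)
    · rw [hX, divX_X_mul_add_C, coeff_zero_X_mul_add_C]
      exact h1.symm

/-- The line through `b m` decouples as a separate eigenspace, so the model is a chain of length
`f.order` plus one dimension, in agreement with the order of `X * f`. -/
theorem algMult_perturb_of_eq_zero (hA : IsDiagonal A b lam)
    (hz : ∃ C, ∀ n, ‖((lam n : ℂ) - z)⁻¹‖ ≤ C) {m : I} (hm : (lam m : ℂ) = z)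
    (hne : ∀ n, n ≠ m → (lam n : ℂ) ≠ z) (φ ψ : H) (ha : inner ℂ φ (b m) = 0)
    (hb : coeff b ψ m = 0) :
    algMult (perturb A φ ψ) z = (PowerSeries.X * regSeries lam (coeffProd b φ ψ) z -
      PowerSeries.C (coeffProd b φ ψ m)).order := by
  set f := regSeries lam (coeffProd b φ ψ) z with hf
  let X : degreeBelow f.order × ℂ →ₗ[ℂ] H := (LinearMap.toSpanSingleton ℂ H (b m)).comp
    (LinearMap.snd ℂ _ _) - ((chainMap b lam z hz ψ).comp (Submodule.subtype _)).comp
      (LinearMap.fst ℂ _ _)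
  have hX : ∀ s, X s = s.2 • b m - chainMap b lam z hz ψ s.1.1 := fun s => rfl
  have hφX : ∀ s, inner ℂ φ (X s) = s.1.1.coeff 0 := fun s => by
    rw [hX, inner_sub_right, inner_smul_right, ha, inner_chainMap, ← hf, pairing_eq_zero s.1.2]
    ring
  have hrank : (PowerSeries.X * f - PowerSeries.C (coeffProd b φ ψ m)).order =
      Cardinal.toENat (Module.rank ℂ (degreeBelow f.order × ℂ)) := by
    rw [coeffProd, ha, mul_zero, map_zero, sub_zero, PowerSeries.order_mul, PowerSeries.order_X,
      rank_prod', map_add, toENat_rank_degreeBelow, rank_self, map_one, add_comm]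
  rw [hrank]
  refine algMult_eq_of_model (V := degreeBelow f.order × ℂ)
    (fun s => (⟨divX s.1.1, divX_mem_degreeBelow s.1.2⟩, 0)) (fun s => ?_) X (fun s => ?_)
    (fun s hs hs' => ?_) fun x s hx => ?_
  · obtain ⟨k, hk⟩ := exists_iterate_divX_eq_zero s.1.1
    refine ⟨k + 1, ?_⟩
    rw [Function.iterate_succ_apply']
    have h := (Function.Semiconj.iterate_right (f := fun s : degreeBelow f.order × ℂ => s.1.1)
      (ga := fun s : degreeBelow f.order × ℂ => (⟨divX s.1.1, divX_mem_degreeBelow s.1.2⟩, 0))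
      (gb := divX) (fun _ => rfl) k).eq s
    rw [hk] at h
    refine Prod.ext (Subtype.ext ?_) rfl
    simp only at h ⊢
    rw [h, divX_zero]
    rfl
  · rw [exists_perturb_apply_eq_iff hA]
    intro n
    rw [hφX, hX, hX, coeff_sub, coeff_sub, coeff_smul, coeff_smul]
    by_cases hn : n = m
    · rw [hn, hm, coeff_chainMap_of_eq hz hm, coeff_chainMap_of_eq hz hm, hb]
      ring
    · have h3 : (lam n : ℂ) - z ≠ 0 := sub_ne_zero.2 (hne n hn)
      rw [coeff_basis_of_ne b hn, coeff_chainMap _ _ s.1.1]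
      field_simp
      ring
  · have h0 := hφX s
    have h1 := congrArg (coeff b · m) hs
    simp only [hX, coeff_sub, coeff_smul, coeff_chainMap_of_eq hz hm, coeff_basis_self] at h1
    rw [hs, inner_zero_right] at h0
    have h2 : divX s.1.1 = 0 := congrArg (fun s => s.1.1) hs'
    refine Prod.ext (Subtype.ext ?_) (by simpa [coeff] using h1)
    rw [← X_mul_divX_add s.1.1, h2, ← h0, C_0, mul_zero, add_zero]
    rfl
  · rw [exists_perturb_apply_eq_iff hA] at hx
    obtain ⟨h1, h2⟩ := eq_smul_sub_chainMap hz hm hne φ ψ x s.1.1 fun n hn => by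
      rw [hx n, hX, coeff_sub, coeff_smul, coeff_basis_of_ne b hn]; ring
    rw [ha, mul_zero] at h2
    refine ⟨(⟨_, mem_degreeBelow_of_pairing_eq_zero ?_ h2⟩, coeff b x m), ?_⟩
    · rw [divX_X_mul_add_C]
      exact s.1.2
    · rw [hX]
      exact h1.symm

/-- The algebraic multiplicity at an eigenvalue of `A`. -/
theorem algMult_perturb_of_eq (hA : IsDiagonal A b lam)
    (hz : ∃ C, ∀ n, ‖((lam n : ℂ) - z)⁻¹‖ ≤ C) {m : I} (hm : (lam m : ℂ) = z)
    (hne : ∀ n, n ≠ m → (lam n : ℂ) ≠ z) (φ ψ : H) :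
    algMult (perturb A φ ψ) z = (PowerSeries.X * regSeries lam (coeffProd b φ ψ) z -
      PowerSeries.C (coeffProd b φ ψ m)).order := by
  by_cases ha : inner ℂ φ (b m) = 0
  · by_cases hb : coeff b ψ m = 0
    · exact algMult_perturb_of_eq_zero hA hz hm hne φ ψ ha hb
    · exact algMult_perturb_of_coeff_ne_zero hA hz hm hne φ ψ ha hb
  · exact algMult_perturb_of_inner_ne_zero hA hz hm hne φ ψ ha

end Multiplicity

end RankOnePert

namespace RankOnePert

/-! ### Taylor series of partial fractions. -/

section PowerSeries

open Filter Topology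

theorem analyticAt_and_order_of_hasSum {f : ℂ → ℂ} {g : PowerSeries ℂ} {z : ℂ}
    (h : ∀ᶠ w in 𝓝 z, HasSum (fun i => (w - z) ^ i * PowerSeries.coeff i g) (f w)) :
    AnalyticAt ℂ f z ∧ analyticOrderAt f z = g.order := by
  set q := FormalMultilinearSeries.ofScalars ℂ (fun i => PowerSeries.coeff i g) with hq
  have hqc : ∀ i, q.coeff i = PowerSeries.coeff i g := fun i => by
    simp [hq, FormalMultilinearSeries.coeff_ofScalars]
  have hf : HasFPowerSeriesAt f q z := by
    rw [hasFPowerSeriesAt_iff']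
    simpa only [hqc, smul_eq_mul] using h
  refine ⟨hf.analyticAt, ?_⟩
  by_cases hg : g = 0
  · rw [hg, PowerSeries.order_zero, analyticOrderAt_eq_top]
    refine h.mono fun w hw => hw.unique ?_
    simp [hg, hasSum_zero]
  have hq0 : q ≠ 0 := fun h0 => hg <| by
    ext i
    rw [← hqc, h0]
    simp [FormalMultilinearSeries.coeff]
  have h1 : analyticOrderAt f z = (q.order : ℕ∞) := by
    rw [hf.analyticAt.analyticOrderAt_eq_natCast]
    exact ⟨_, (hf.has_fpower_series_iterate_dslope_fslope q.order).analyticAt,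
      hf.iterate_dslope_fslope_ne_zero hq0, Eventually.of_forall hf.eq_pow_order_mul_iterate_dslope⟩
  rw [h1, eq_comm, PowerSeries.order_eq_nat]
  refine ⟨?_, fun i hi => ?_⟩
  · rw [← hqc, Ne, FormalMultilinearSeries.coeff_eq_zero]
    exact FormalMultilinearSeries.apply_order_ne_zero hq0
  · rw [← hqc, FormalMultilinearSeries.coeff_eq_zero]
    exact q.apply_eq_zero_of_lt_order hi

theorem hasSum_X_mul_sub {g : PowerSeries ℂ} {u s : ℂ} (k : ℂ)
    (h : HasSum (fun i => u ^ i * PowerSeries.coeff i g) s) :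
    HasSum (fun i => u ^ i * PowerSeries.coeff i (PowerSeries.X * g - PowerSeries.C k))
      (u * s - k) := by
  rw [← hasSum_nat_add_iff' 1]
  have : u * s - k - ∑ i ∈ Finset.range 1,
      u ^ i * PowerSeries.coeff i (PowerSeries.X * g - PowerSeries.C k) = u * s := by simp
  rw [this]
  refine (h.mul_left u).congr_fun fun i => ?_
  simp [PowerSeries.coeff_succ_X_mul]
  ring

end PowerSeries

section PartialFractions

open Filter Topology

variable {I : Type*} {lam : I → ℝ}

/-- The function `w ↦ 1 + ∑ c n / (lam n - w)`. -/
noncomputable def pfrac (lam : I → ℝ) (c : I → ℂ) (w : ℂ) : ℂ :=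
  1 + ∑' n, c n * ((lam n : ℂ) - w)⁻¹

open Classical in
/-- The sequence `c` with the entries belonging to the pole `z` removed. -/
noncomputable def awayFrom (lam : I → ℝ) (c : I → ℂ) (z : ℂ) (n : I) : ℂ :=
  if (lam n : ℂ) = z then 0 else c n

open Classical in
/-- The order of the pole at `z` of a generic series of partial fractions. -/
noncomputable def poleOrder (lam : I → ℝ) (z : ℂ) : ℕ := if ∃ n, (lam n : ℂ) = z then 1 else 0

open Classical in
/-- The function `w ↦ (w - z) ^ poleOrder lam z * pfrac lam c w`, with the singularity at `z`
removed. -/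
noncomputable def numer (lam : I → ℝ) (c : I → ℂ) (z w : ℂ) : ℂ :=
  (w - z) ^ poleOrder lam z * pfrac lam (awayFrom lam c z) w -
    ∑' n, if (lam n : ℂ) = z then c n else 0

theorem summable_mul_inv {c : I → ℂ} (hc : Summable fun n => ‖c n‖) {w : ℂ}
    (hw : ∃ C, ∀ n, ‖((lam n : ℂ) - w)⁻¹‖ ≤ C) :
    Summable fun n => c n * ((lam n : ℂ) - w)⁻¹ := by
  obtain ⟨C, hC⟩ := hw
  refine Summable.of_norm_bounded (hc.mul_right C) fun n => ?_
  rw [norm_mul]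
  gcongr
  exact hC n

theorem norm_awayFrom_le (c : I → ℂ) (z : ℂ) (n : I) : ‖awayFrom lam c z n‖ ≤ ‖c n‖ := by
  unfold awayFrom
  split_ifs <;> simp

theorem summable_awayFrom {c : I → ℂ} (hc : Summable fun n => ‖c n‖) (z : ℂ) :
    Summable fun n => ‖awayFrom lam c z n‖ :=
  hc.of_nonneg_of_le (fun _ => norm_nonneg _) (norm_awayFrom_le c z)

theorem regSeries_awayFrom (c : I → ℂ) (z : ℂ) :
    regSeries lam (awayFrom lam c z) z = regSeries lam c z := by
  unfold regSeries awayFrom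
  congr 1
  ext i
  congr 1
  refine tsum_congr fun n => ?_
  split_ifs with h
  · simp [h]
  · rfl

/-- Each term is a geometric series in `(w - z) / (lam n - z)`. The radius `(2 * K)⁻¹` keeps all
ratios below `1 / 2`, so the double series converges absolutely and may be summed in either order.
-/
theorem hasSum_pfrac {c : I → ℂ} (hc : Summable fun n => ‖c n‖) {z : ℂ}
    (hz : ∃ C, ∀ n, ‖((lam n : ℂ) - z)⁻¹‖ ≤ C) (hcz : ∀ n, (lam n : ℂ) = z → c n = 0) :
    ∀ᶠ w in 𝓝 z, HasSum (fun i => (w - z) ^ i * PowerSeries.coeff i (regSeries lam c z))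
      (pfrac lam c w) := by
  obtain ⟨C, hC⟩ := hz
  set K := max C 1
  have hK : 0 < K := lt_max_of_lt_right one_pos
  have hCK : ∀ n, ‖((lam n : ℂ) - z)⁻¹‖ ≤ K := fun n => (hC n).trans (le_max_left _ _)
  filter_upwards [Metric.ball_mem_nhds z (show 0 < (2 * K)⁻¹ by positivity)] with w hw
  have hw' : ‖w - z‖ * K ≤ 1 / 2 := by
    have : ‖w - z‖ ≤ (2 * K)⁻¹ := (mem_ball_iff_norm.1 hw).le
    calc ‖w - z‖ * K ≤ (2 * K)⁻¹ * K := by gcongr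
      _ = 1 / 2 := by field_simp
  have hwn : ∀ n, ‖(w - z) * ((lam n : ℂ) - z)⁻¹‖ ≤ 1 / 2 := fun n => by
    rw [norm_mul]
    exact (mul_le_mul_of_nonneg_left (hCK n) (norm_nonneg _)).trans hw'
  set f : I × ℕ → ℂ := fun p =>
    c p.1 * ((lam p.1 : ℂ) - z)⁻¹ * ((w - z) * ((lam p.1 : ℂ) - z)⁻¹) ^ p.2 with hf
  have hfs : Summable f := by
    have hb : Summable fun p : I × ℕ => (‖c p.1‖ * K) * (1 / 2 : ℝ) ^ p.2 :=
      (hc.mul_right K).mul_of_nonneg summable_geometric_two (fun n => by positivity)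
        (fun i => by positivity)
    refine Summable.of_norm_bounded hb fun p => ?_
    rw [hf]
    simp only [norm_mul _ (_ ^ _), norm_mul (c _), norm_pow]
    gcongr
    · exact hCK _
    · exact hwn _
  have h1 : ∀ n, HasSum (fun i => f (n, i)) (c n * ((lam n : ℂ) - w)⁻¹) := by
    intro n
    by_cases hn : (lam n : ℂ) = z
    · simp [hf, hcz n hn, hasSum_zero]
    have h2 := (hasSum_geometric_of_norm_lt_one
      ((hwn n).trans_lt (by norm_num))).mul_left (c n * ((lam n : ℂ) - z)⁻¹)
    have h3 : c n * ((lam n : ℂ) - z)⁻¹ * (1 - (w - z) * ((lam n : ℂ) - z)⁻¹)⁻¹ =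
        c n * ((lam n : ℂ) - w)⁻¹ := by
      rw [mul_assoc, ← mul_inv, mul_sub, mul_one, mul_left_comm,
        mul_inv_cancel₀ (sub_ne_zero.2 hn), mul_one, sub_sub_sub_cancel_right]
    rwa [h3] at h2
  have h2 : HasSum (fun n => c n * ((lam n : ℂ) - w)⁻¹) (∑' p, f p) :=
    hfs.hasSum.prod_fiberwise h1
  have h3 : HasSum (fun i => ∑' n, f (n, i)) (∑' p, f p) := by
    have h4 : HasSum (fun p : ℕ × I => f p.swap) (∑' p, f p) :=
      (Equiv.prodComm ℕ I).hasSum_iff.2 hfs.hasSum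
    exact h4.prod_fiberwise fun i => (h4.summable.prod_factor i).hasSum
  rw [pfrac, h2.tsum_eq]
  have h4 : HasSum (fun i : ℕ => (w - z) ^ i * (if i = 0 then 1 else 0)) (1 : ℂ) := by
    convert hasSum_ite_eq 0 (1 : ℂ) using 2 with i
    by_cases hi : i = 0 <;> simp [hi]
  refine (h4.add h3).congr_fun fun i => ?_
  rw [regSeries, PowerSeries.coeff_mk, mul_add, ← tsum_mul_left]
  congr 1
  refine tsum_congr fun n => ?_
  rw [hf]
  simp only
  rw [mul_pow, pow_succ]
  ring

end PartialFractions

end RankOnePert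

namespace RankOnePert

/-! ### Multiplicity as the order of a zero. -/

section Numerator

open Filter Topology

variable {I : Type*} {lam : I → ℝ}

theorem analyticAt_pfrac {c : I → ℂ} (hc : Summable fun n => ‖c n‖) {z : ℂ}
    (hz : ∃ C, ∀ n, ‖((lam n : ℂ) - z)⁻¹‖ ≤ C) (hcz : ∀ n, (lam n : ℂ) = z → c n = 0) :
    AnalyticAt ℂ (pfrac lam c) z :=
  (analyticAt_and_order_of_hasSum (hasSum_pfrac hc hz hcz)).1

theorem awayFrom_apply_of_eq (c : I → ℂ) {z : ℂ} {n : I} (h : (lam n : ℂ) = z) :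
    awayFrom lam c z n = 0 := if_pos h

theorem analyticAt_numer {c : I → ℂ} (hc : Summable fun n => ‖c n‖) {z : ℂ}
    (hz : ∃ C, ∀ n, ‖((lam n : ℂ) - z)⁻¹‖ ≤ C) : AnalyticAt ℂ (numer lam c z) z := by
  have := analyticAt_pfrac (summable_awayFrom hc z) hz fun n => awayFrom_apply_of_eq c
  unfold numer
  fun_prop

theorem numer_of_forall_ne (c : I → ℂ) {z : ℂ} (h : ∀ n, (lam n : ℂ) ≠ z) :
    numer lam c z = pfrac lam c := by
  funext w
  have h1 : awayFrom lam c z = c := funext fun n => if_neg (h n)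
  simp [numer, poleOrder, h, h1]

theorem tsum_ite_eq_of_forall_ne (c : I → ℂ) {z : ℂ} {m : I} (hm : (lam m : ℂ) = z)
    (hne : ∀ n, n ≠ m → (lam n : ℂ) ≠ z) [DecidablePred fun n => (lam n : ℂ) = z] :
    ∑' n, (if (lam n : ℂ) = z then c n else 0) = c m := by
  rw [tsum_eq_single m fun n hn => if_neg (hne n hn), if_pos hm]

theorem numer_of_eq (c : I → ℂ) {z : ℂ} {m : I} (hm : (lam m : ℂ) = z)
    (hne : ∀ n, n ≠ m → (lam n : ℂ) ≠ z) (w : ℂ) :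
    numer lam c z w = (w - z) * pfrac lam (awayFrom lam c z) w - c m := by
  classical
  rw [numer, poleOrder, if_pos ⟨m, hm⟩, pow_one, tsum_ite_eq_of_forall_ne c hm hne]

/-- The pole term contributes `(w - z) * c m / (z - w) = -c m`, the constant in `numer`. The point
`w` may be another `lam n`; both sides then drop that term through `0⁻¹ = 0`. -/
theorem numer_eq_pow_mul (hinj : Function.Injective lam) {c : I → ℂ}
    (hc : Summable fun n => ‖c n‖) (z : ℂ) {w : ℂ} (hw : ∃ C, ∀ n, ‖((lam n : ℂ) - w)⁻¹‖ ≤ C)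
    (hwz : w ≠ z) : numer lam c z w = (w - z) ^ poleOrder lam z * pfrac lam c w := by
  classical
  by_cases h : ∃ m, (lam m : ℂ) = z
  · obtain ⟨m, hm⟩ := h
    have hne : ∀ n, n ≠ m → (lam n : ℂ) ≠ z := fun n hn h =>
      hn (hinj (by exact_mod_cast h.trans hm.symm))
    rw [numer_of_eq c hm hne, poleOrder, if_pos ⟨m, hm⟩, pow_one, pfrac, pfrac]
    have h1 := (summable_mul_inv hc hw).tsum_eq_add_tsum_ite m
    have h2 : ∑' n, awayFrom lam c z n * ((lam n : ℂ) - w)⁻¹ =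
        ∑' n, if n = m then 0 else c n * ((lam n : ℂ) - w)⁻¹ := by
      refine tsum_congr fun n => ?_
      by_cases hn : n = m
      · simp [hn, awayFrom, hm]
      · simp [hn, awayFrom, hne n hn]
    rw [h1, h2, hm]
    have : z - w ≠ 0 := sub_ne_zero.2 hwz.symm
    field_simp
    ring
  · push Not at h
    rw [numer_of_forall_ne c h]
    simp [poleOrder, h]

theorem analyticOrderAt_numer_of_forall_ne {c : I → ℂ} (hc : Summable fun n => ‖c n‖) {z : ℂ}
    (hz : ∃ C, ∀ n, ‖((lam n : ℂ) - z)⁻¹‖ ≤ C) (h : ∀ n, (lam n : ℂ) ≠ z) :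
    analyticOrderAt (numer lam c z) z = (regSeries lam c z).order := by
  rw [numer_of_forall_ne c h]
  exact (analyticAt_and_order_of_hasSum (hasSum_pfrac hc hz fun n hn => absurd hn (h n))).2

theorem analyticOrderAt_numer_of_eq {c : I → ℂ} (hc : Summable fun n => ‖c n‖) {z : ℂ}
    (hz : ∃ C, ∀ n, ‖((lam n : ℂ) - z)⁻¹‖ ≤ C) {m : I} (hm : (lam m : ℂ) = z)
    (hne : ∀ n, n ≠ m → (lam n : ℂ) ≠ z) :
    analyticOrderAt (numer lam c z) z =
      (PowerSeries.X * regSeries lam c z - PowerSeries.C (c m)).order := by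
  refine (analyticAt_and_order_of_hasSum ?_).2
  filter_upwards [hasSum_pfrac (summable_awayFrom hc z) hz fun n => awayFrom_apply_of_eq c]
    with w hw
  rw [regSeries_awayFrom] at hw
  rw [numer_of_eq c hm hne]
  exact hasSum_X_mul_sub _ hw

theorem summable_norm_coeffProd {H : Type*} [NormedAddCommGroup H] [InnerProductSpace ℂ H]
    (b : HilbertBasis I ℂ H) (φ ψ : H) : Summable fun n => ‖coeffProd b φ ψ n‖ :=
  (hasSum_coeffProd b φ ψ).summable.norm

/-- The algebraic multiplicities of the perturbed operator are the orders of the zeros of the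
numerators of the perturbation determinant. -/
theorem algMult_perturb {H : Type*} [NormedAddCommGroup H] [InnerProductSpace ℂ H]
    {A : H →ₗ.[ℂ] H} {b : HilbertBasis I ℂ H} (hinj : Function.Injective lam)
    (hA : IsDiagonal A b lam) {z : ℂ} (hz : ∃ C, ∀ n, ‖((lam n : ℂ) - z)⁻¹‖ ≤ C) (φ ψ : H) :
    algMult (perturb A φ ψ) z = analyticOrderAt (numer lam (coeffProd b φ ψ) z) z := by
  by_cases h : ∃ m, (lam m : ℂ) = z
  · obtain ⟨m, hm⟩ := h
    have hne : ∀ n, n ≠ m → (lam n : ℂ) ≠ z := fun n hn h =>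
      hn (hinj (by exact_mod_cast h.trans hm.symm))
    rw [algMult_perturb_of_eq hA hz hm hne,
      analyticOrderAt_numer_of_eq (summable_norm_coeffProd b φ ψ) hz hm hne]
  · push Not at h
    rw [algMult_perturb_of_forall_ne hA hz h,
      analyticOrderAt_numer_of_forall_ne (summable_norm_coeffProd b φ ψ) hz h]

end Numerator

/-! ### Uniqueness of the coefficients by Liouville's theorem. -/

section Uniqueness

open Filter Topology

variable {I : Type*} {lam : I → ℝ}

/-- A quotient whose singularities are all removable. -/
theorem exists_differentiable_eq_mul {F G : ℂ → ℂ}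
    (h : ∀ z, ∃ q : ℂ → ℂ, AnalyticAt ℂ q z ∧ ∀ᶠ w in 𝓝[≠] z, F w = q w * G w ∧ G w ≠ 0) :
    ∃ Q : ℂ → ℂ, Differentiable ℂ Q ∧ ∀ z, ∀ᶠ w in 𝓝[≠] z, F w = Q w * G w := by
  choose q hq hFG using h
  -- Two local quotients agree on a punctured neighbourhood of `w` because `G` is nonzero there; by
  -- continuity they agree at `w`. So the diagonal `w ↦ q w w` is locally one of them.
  have key : ∀ z, (fun w => q w w) =ᶠ[𝓝 z] q z := by
    intro z
    have h1 : ∀ᶠ w in 𝓝 z, ∀ᶠ u in 𝓝[≠] w, F u = q z u * G u := by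
      have := (hFG z).mono fun w hw => hw.1
      rw [eventually_nhdsWithin_iff] at this
      filter_upwards [this.eventually_nhds, this] with w hw _
      by_cases hwz : w = z
      · rw [hwz]; exact (hFG z).mono fun w hw => hw.1
      · filter_upwards [hw.filter_mono nhdsWithin_le_nhds,
          mem_nhdsWithin_of_mem_nhds (isOpen_ne.mem_nhds hwz)] with u hu hu'
        exact hu hu'
    filter_upwards [h1, (hq z).eventually_analyticAt] with w hw hw'
    have h2 : q w =ᶠ[𝓝[≠] w] q z := by
      filter_upwards [hw, hFG w] with u hu hu'
      exact mul_right_cancel₀ hu'.2 (hu'.1.symm.trans hu)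
    exact tendsto_nhds_unique_of_eventuallyEq
      ((hq w).continuousAt.tendsto.mono_left nhdsWithin_le_nhds)
      (hw'.continuousAt.tendsto.mono_left nhdsWithin_le_nhds) h2
  refine ⟨fun w => q w w, fun z => ?_, fun z => ?_⟩
  · exact ((hq z).congr (key z).symm).differentiableAt
  · filter_upwards [hFG z, (key z).filter_mono nhdsWithin_le_nhds] with w hw hw'
    rw [hw.1, hw']

/-- The points at distance at least `r` from all poles. -/
def farFrom (lam : I → ℝ) (r : ℝ) : Set ℂ := {w | ∀ n, r ≤ ‖(lam n : ℂ) - w‖}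

theorem norm_inv_le_of_mem_farFrom {r : ℝ} (hr : 0 < r) {w : ℂ} (hw : w ∈ farFrom lam r) (n : I) :
    ‖((lam n : ℂ) - w)⁻¹‖ ≤ r⁻¹ := by
  rw [norm_inv]
  exact inv_anti₀ hr (hw n)

/-- Dominated convergence: each term tends to 0 and is at most `‖c n‖ * r⁻¹` on `farFrom lam r`. -/
theorem tendsto_pfrac {c : I → ℂ} (hc : Summable fun n => ‖c n‖) {r : ℝ} (hr : 0 < r) :
    Tendsto (pfrac lam c) (Bornology.cobounded ℂ ⊓ 𝓟 (farFrom lam r)) (𝓝 1) := by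
  have h : Tendsto (fun w : ℂ => ∑' n, c n * ((lam n : ℂ) - w)⁻¹)
      (Bornology.cobounded ℂ ⊓ 𝓟 (farFrom lam r)) (𝓝 (∑' _ : I, (0 : ℂ))) := by
    refine tendsto_tsum_of_dominated_convergence (hc.mul_right r⁻¹) (fun n => ?_) ?_
    · have h1 : Tendsto (fun w : ℂ => (lam n : ℂ) - w) (Bornology.cobounded ℂ)
          (Bornology.cobounded ℂ) := tendsto_const_sub_cobounded _
      have h2 := (tendsto_inv₀_cobounded.comp h1).const_mul (c n)
      rw [mul_zero] at h2
      exact h2.mono_left inf_le_left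
    · refine eventually_inf_principal.2 (Eventually.of_forall fun w hw n => ?_)
      rw [norm_mul]
      gcongr
      exact norm_inv_le_of_mem_farFrom hr hw n
  rw [tsum_zero] at h
  have h1 := h.const_add 1
  rw [add_zero] at h1
  exact h1

theorem neBot_cobounded_inf_farFrom (lam : I → ℝ) (r : ℝ) :
    (Bornology.cobounded ℂ ⊓ 𝓟 (farFrom lam r)).NeBot := by
  have h : Tendsto (fun y : ℝ => (y : ℂ) * Complex.I) atTop
      (Bornology.cobounded ℂ ⊓ 𝓟 (farFrom lam r)) := by
    refine tendsto_inf.2 ⟨?_, tendsto_principal.2 ?_⟩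
    · rw [← tendsto_norm_atTop_iff_cobounded]
      refine tendsto_atTop_mono (fun y => ?_) tendsto_id
      simpa using le_abs_self y
    · filter_upwards [eventually_ge_atTop r] with y hy n
      have := Complex.abs_im_le_norm ((lam n : ℂ) - y * Complex.I)
      simp only [Complex.sub_im, Complex.ofReal_im, Complex.mul_im, Complex.ofReal_re, Complex.I_im,
        mul_one, Complex.I_re, mul_zero, add_zero, zero_sub, abs_neg] at this
      exact hy.trans ((le_abs_self y).trans this)
  exact h.neBot

/-- An entire function bounded far away from separated poles is constant. -/
theorem apply_eq_apply_of_bounded_farFrom {d : ℝ} (hd : 0 < d)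
    (hsep : ∀ m n, m ≠ n → d ≤ |lam m - lam n|) {Q : ℂ → ℂ} (hQ : Differentiable ℂ Q) {K : ℝ}
    (hK : ∀ᶠ w in Bornology.cobounded ℂ ⊓ 𝓟 (farFrom lam (d / 4)), ‖Q w‖ ≤ K) (z w : ℂ) :
    Q z = Q w := by
  refine hQ.apply_eq_apply_of_bounded ?_ z w
  obtain ⟨R, -, hR⟩ := (Metric.hasBasis_cobounded_compl_closedBall (0 : ℂ)).eventually_iff.1
    (eventually_inf_principal.1 hK)
  have hR' : ∀ u : ℂ, R < ‖u‖ → u ∈ farFrom lam (d / 4) → ‖Q u‖ ≤ K :=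
    fun u hu => hR (by simpa using hu)
  obtain ⟨K', hK'⟩ := (isCompact_closedBall (0 : ℂ) (R + d)).exists_bound_of_continuousOn
    hQ.continuous.continuousOn
  rw [isBounded_iff_forall_norm_le]
  refine ⟨max K K', ?_⟩
  rintro _ ⟨u, rfl⟩
  by_cases hu : ‖u‖ ≤ R + d
  · exact (hK' u (by simpa using hu)).trans (le_max_right _ _)
  refine le_trans ?_ (le_max_left _ _)
  push Not at hu
  by_cases hfar : u ∈ farFrom lam (d / 4)
  · exact hR' u (by linarith) hfar
  simp only [farFrom, Set.mem_ofPred_eq, not_forall, not_le] at hfar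
  obtain ⟨n, hn⟩ := hfar
  -- Maximum principle on the disc around the nearby pole: its boundary circle keeps distance `d /
  -- 4` from all poles by separation, and stays outside radius `R` because `‖u‖ > R + d`.
  refine Complex.norm_le_of_forall_mem_frontier_norm_le (U := Metric.ball (lam n : ℂ) (d / 4))
    Metric.isBounded_ball hQ.diffContOnCl (fun s hs => ?_) (subset_closure ?_)
  · rw [frontier_ball _ (by positivity), mem_sphere_iff_norm] at hs
    refine hR' s ?_ fun m => ?_
    · have h1 : ‖u‖ ≤ ‖s‖ + ‖s - (lam n : ℂ)‖ + ‖(lam n : ℂ) - u‖ := by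
        have := norm_sub_le (s - (s - (lam n : ℂ))) ((lam n : ℂ) - u)
        have h2 := norm_sub_le s (s - (lam n : ℂ))
        rw [show s - (s - (lam n : ℂ)) - ((lam n : ℂ) - u) = u by ring] at this
        linarith
      linarith
    · by_cases hmn : m = n
      · rw [hmn, norm_sub_rev, hs]
      · have h1 := hsep m n hmn
        have h2 : |lam m - lam n| ≤ ‖(lam m : ℂ) - s‖ + ‖s - (lam n : ℂ)‖ := by
          have := norm_add_le ((lam m : ℂ) - s) (s - (lam n : ℂ))
          rw [sub_add_sub_cancel, ← Complex.ofReal_sub, Complex.norm_real] at this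
          exact this
        linarith
  · rw [mem_ball_iff_norm, norm_sub_rev]
    exact hn

/-- The coefficients of a series of partial fractions are determined by its zeros. -/
theorem eq_of_analyticOrderAt_numer_eq {d : ℝ} (hd : 0 < d)
    (hsep : ∀ m n, m ≠ n → d ≤ |lam m - lam n|) {c c' : I → ℂ} (hc : Summable fun n => ‖c n‖)
    (hc' : Summable fun n => ‖c' n‖)
    (h : ∀ z, analyticOrderAt (numer lam c z) z = analyticOrderAt (numer lam c' z) z)
    (hfin : ∀ z, analyticOrderAt (numer lam c' z) z ≠ ⊤) : c = c' := by
  have hinj := injective_of_separated hd hsep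
  have hbd := exists_norm_inv_sub_le hd hsep
  obtain ⟨Q, hQ, hFG⟩ := exists_differentiable_eq_mul (F := pfrac lam c) (G := pfrac lam c')
    fun z => by
      have hfin' := hfin z
      obtain ⟨g', hg', hg'0, hg'e⟩ := (analyticAt_numer hc' (hbd z)).analyticOrderAt_ne_top.1 hfin'
      obtain ⟨g, hg, hg0, hge⟩ := (analyticAt_numer hc (hbd z)).analyticOrderAt_ne_top.1
        (by rwa [h z])
      have hord : analyticOrderNatAt (numer lam c z) z = analyticOrderNatAt (numer lam c' z) z := by
        rw [analyticOrderNatAt, h z, analyticOrderNatAt]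
      -- Equal orders cancel the powers of `w - z`, leaving a quotient of analytic factors that do
      -- not vanish at `z`.
      refine ⟨fun w => g w / g' w, hg.div hg' hg'0, ?_⟩
      filter_upwards [hg'e.filter_mono nhdsWithin_le_nhds, hge.filter_mono nhdsWithin_le_nhds,
        (hg'.continuousAt.eventually_ne hg'0).filter_mono nhdsWithin_le_nhds,
        self_mem_nhdsWithin] with w h1 h2 h3 h4
      have h4' : w - z ≠ 0 := sub_ne_zero.2 h4
      rw [numer_eq_pow_mul hinj hc' z (hbd w) h4, smul_eq_mul] at h1
      rw [numer_eq_pow_mul hinj hc z (hbd w) h4, smul_eq_mul, hord] at h2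
      set p := analyticOrderNatAt (numer lam c' z) z
      have h5 : (w - z) ^ poleOrder lam z ≠ 0 := pow_ne_zero _ h4'
      have h6 : (w - z) ^ p ≠ 0 := pow_ne_zero _ h4'
      refine ⟨mul_left_cancel₀ h5 ?_, fun h0 => ?_⟩
      · rw [h2, mul_left_comm, h1]
        field_simp
      · rw [h0, mul_zero] at h1
        exact mul_ne_zero h6 h3 h1.symm
  have hd4 : 0 < d / 4 := by positivity
  have hfar : ∀ w ∈ farFrom lam (d / 4), pfrac lam c w = Q w * pfrac lam c' w := by
    intro w hw
    have hne : ∀ n, (lam n : ℂ) ≠ w := fun n hn => by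
      have := hw n
      rw [hn, sub_self, norm_zero] at this
      linarith
    have h1 := (analyticAt_pfrac hc (hbd w) fun n hn => absurd hn (hne n)).continuousAt
    have h2 := (analyticAt_pfrac hc' (hbd w) fun n hn => absurd hn (hne n)).continuousAt
    exact tendsto_nhds_unique_of_eventuallyEq (h1.tendsto.mono_left nhdsWithin_le_nhds)
      ((hQ.continuous.continuousAt.mul h2).tendsto.mono_left nhdsWithin_le_nhds) (hFG w)
  set L := Bornology.cobounded ℂ ⊓ 𝓟 (farFrom lam (d / 4)) with hL
  have : L.NeBot := neBot_cobounded_inf_farFrom lam _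
  have hF : Tendsto (pfrac lam c) L (𝓝 1) := tendsto_pfrac hc hd4
  have hG : Tendsto (pfrac lam c') L (𝓝 1) := tendsto_pfrac hc' hd4
  have hLfar : ∀ᶠ w in L, w ∈ farFrom lam (d / 4) := mem_inf_of_right (mem_principal_self _)
  have hQ1 : Tendsto Q L (𝓝 1) := by
    have h1 := hF.div hG one_ne_zero
    rw [div_one] at h1
    refine h1.congr' ?_
    filter_upwards [hLfar, hG.eventually_ne one_ne_zero] with w hw hw'
    rw [Pi.div_apply, hfar w hw, mul_div_cancel_right₀ _ hw']
  have hQb : ∀ᶠ w in L, ‖Q w‖ ≤ 2 :=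
    (hQ1.norm.eventually_le_const (by simp : ‖(1 : ℂ)‖ < 2))
  have hQconst : ∀ w, Q w = 1 := fun w => by
    have h1 : Tendsto Q L (𝓝 (Q w)) := tendsto_const_nhds.congr
      fun u => apply_eq_apply_of_bounded_farFrom hd hsep hQ hQb w u
    exact tendsto_nhds_unique h1 hQ1
  funext m
  have hne : ∀ n, n ≠ m → (lam n : ℂ) ≠ (lam m : ℂ) := fun n hn h =>
    hn (hinj (by exact_mod_cast h))
  -- The value of the numerator at `lam m` is minus the coefficient with index `m`.
  have h1 : numer lam c (lam m) =ᶠ[𝓝[≠] (lam m : ℂ)] numer lam c' (lam m) := by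
    filter_upwards [hFG (lam m), self_mem_nhdsWithin] with w hw hw'
    rw [numer_eq_pow_mul hinj hc _ (hbd w) hw', numer_eq_pow_mul hinj hc' _ (hbd w) hw', hw,
      hQconst, one_mul]
  have h2 := tendsto_nhds_unique_of_eventuallyEq
    ((analyticAt_numer hc (hbd (lam m))).continuousAt.tendsto.mono_left nhdsWithin_le_nhds)
    ((analyticAt_numer hc' (hbd (lam m))).continuousAt.tendsto.mono_left nhdsWithin_le_nhds) h1
  rw [numer_of_eq c rfl hne, numer_of_eq c' rfl hne, sub_self, zero_mul, zero_mul, zero_sub,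
    zero_sub] at h2
  exact neg_injective h2

end Uniqueness

end RankOnePert

namespace RankOnePert

/-! ### Prescribed zeros by an infinite product. -/

section InfiniteProduct

open Filter Topology

variable {I : Type*} {lam : I → ℝ}

/-- The product `∏ (1 + ε n / (lam n - w))`, i.e. `∏ (lam n + ε n - w) / (lam n - w)`. -/
noncomputable def prodDet (lam : I → ℝ) (ε : I → ℂ) (w : ℂ) : ℂ :=
  ∏' n, (1 + ε n * ((lam n : ℂ) - w)⁻¹)

/-- The inner product may run over all of `J`, since its factor `m = n` is 1 by `0⁻¹ = 0`. In the
induction the new coefficient involves the old product at `lam k`, so the hypothesis is applied both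
at `w` and at `lam k`. -/
theorem prod_one_add_eq_sum [DecidableEq I] (hinj : Function.Injective lam) (ε : I → ℂ)
    (J : Finset I) (w : ℂ) (hw : ∀ n ∈ J, (lam n : ℂ) = w → ε n = 0) :
    ∏ n ∈ J, (1 + ε n * ((lam n : ℂ) - w)⁻¹) = 1 + ∑ n ∈ J,
      ε n * (∏ m ∈ J, (1 + ε m * ((lam m : ℂ) - lam n)⁻¹)) * ((lam n : ℂ) - w)⁻¹ := by
  induction J using Finset.induction_on generalizing w with
  | empty => simp
  | insert k J hk ih =>
    have h1 := ih w fun n hn => hw n (Finset.mem_insert_of_mem hn)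
    have hJ : ∀ n ∈ J, (lam n : ℂ) ≠ lam k := fun n hn h =>
      hk (hinj (show lam n = lam k by exact_mod_cast h) ▸ hn)
    have h2 := ih (lam k) fun n hn h => absurd h (hJ n hn)
    have hkw := hw k (Finset.mem_insert_self _ _)
    rw [Finset.prod_insert hk, Finset.sum_insert hk, Finset.prod_insert hk, sub_self, inv_zero,
      mul_zero, add_zero, one_mul, h2, h1]
    set P : I → ℂ := fun n => ∏ m ∈ J, (1 + ε m * ((lam m : ℂ) - lam n)⁻¹) with hP
    have h3 : ∑ n ∈ J, ε n * (∏ m ∈ insert k J, (1 + ε m * ((lam m : ℂ) - lam n)⁻¹)) *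
        ((lam n : ℂ) - w)⁻¹ = ∑ n ∈ J, ε n * P n * ((lam n : ℂ) - w)⁻¹ +
        (ε k * ((lam k : ℂ) - w)⁻¹) * ∑ n ∈ J, ε n * P n * ((lam n : ℂ) - w)⁻¹ -
        (ε k * ((lam k : ℂ) - w)⁻¹) * ∑ n ∈ J, ε n * P n * ((lam n : ℂ) - lam k)⁻¹ := by
      rw [Finset.mul_sum, Finset.mul_sum, ← Finset.sum_add_distrib, ← Finset.sum_sub_distrib]
      refine Finset.sum_congr rfl fun n hn => ?_
      rw [Finset.prod_insert hk]
      change ε n * ((1 + ε k * ((lam k : ℂ) - lam n)⁻¹) * P n) * ((lam n : ℂ) - w)⁻¹ = _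
      by_cases hn0 : ε n = 0
      · simp [hn0]
      by_cases hk0 : ε k = 0
      · simp [hk0]
      have e1 : (lam n : ℂ) - w ≠ 0 := sub_ne_zero.2 fun h =>
        hn0 (hw n (Finset.mem_insert_of_mem hn) h)
      have e2 : (lam k : ℂ) - w ≠ 0 := sub_ne_zero.2 fun h => hk0 (hkw h)
      have e3 : (lam n : ℂ) - lam k ≠ 0 := sub_ne_zero.2 (hJ n hn)
      have e4 : (lam k : ℂ) - lam n = -((lam n : ℂ) - lam k) := by ring
      rw [e4, inv_neg]
      field_simp
      ring
    rw [h3]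
    ring

theorem norm_prod_one_add_le (u : I → ℂ) (hu : Summable fun n => ‖u n‖) (J : Finset I) :
    ‖∏ n ∈ J, (1 + u n)‖ ≤ Real.exp (∑' n, ‖u n‖) := by
  calc ‖∏ n ∈ J, (1 + u n)‖ = ∏ n ∈ J, ‖1 + u n‖ := norm_prod _ _
    _ ≤ ∏ n ∈ J, Real.exp ‖u n‖ := by
      refine Finset.prod_le_prod (fun _ _ => norm_nonneg _) fun n _ => ?_
      calc ‖1 + u n‖ ≤ ‖u n‖ + 1 := by simpa [add_comm] using norm_add_le 1 (u n)
        _ ≤ Real.exp ‖u n‖ := Real.add_one_le_exp _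
    _ = Real.exp (∑ n ∈ J, ‖u n‖) := (Real.exp_sum _ _).symm
    _ ≤ Real.exp (∑' n, ‖u n‖) :=
      Real.exp_le_exp.2 (hu.sum_le_tsum _ fun _ _ => norm_nonneg _)

variable {d : ℝ}

theorem norm_inv_sub_le (hd : 0 < d) (hsep : ∀ m n, m ≠ n → d ≤ |lam m - lam n|) (m n : I) :
    ‖((lam m : ℂ) - lam n)⁻¹‖ ≤ d⁻¹ := by
  by_cases h : m = n
  · simp [h, hd.le]
  · rw [norm_inv, ← Complex.ofReal_sub, Complex.norm_real]
    exact inv_anti₀ hd (hsep m n h)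

/-- Uniformity in both `n` and `J` matters: it provides the dominating series for the passage to the
infinite product, and the bounded factor that preserves `ℓ₂`. -/
theorem norm_prod_poles_le (hd : 0 < d) (hsep : ∀ m n, m ≠ n → d ≤ |lam m - lam n|) {ε : I → ℂ}
    (hε : Summable fun n => ‖ε n‖) (n : I) (J : Finset I) :
    ‖∏ m ∈ J, (1 + ε m * ((lam m : ℂ) - lam n)⁻¹)‖ ≤ Real.exp ((∑' m, ‖ε m‖) * d⁻¹) := by
  have h0 : ∀ m, ‖ε m * ((lam m : ℂ) - lam n)⁻¹‖ ≤ ‖ε m‖ * d⁻¹ := fun m => by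
    rw [norm_mul]
    gcongr
    exact norm_inv_sub_le hd hsep m n
  have h1 : Summable fun m => ‖ε m * ((lam m : ℂ) - lam n)⁻¹‖ :=
    (hε.mul_right d⁻¹).of_nonneg_of_le (fun _ => norm_nonneg _) h0
  refine (norm_prod_one_add_le _ h1 J).trans (Real.exp_le_exp.2 ?_)
  rw [← tsum_mul_right]
  exact h1.tsum_le_tsum h0 (hε.mul_right _)

theorem multipliable_prodDet {ε : I → ℂ} (hε : Summable fun n => ‖ε n‖) {w : ℂ}
    (hw : ∃ C, ∀ n, ‖((lam n : ℂ) - w)⁻¹‖ ≤ C) :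
    Multipliable fun n => 1 + ε n * ((lam n : ℂ) - w)⁻¹ :=
  multipliable_one_add_of_summable (summable_mul_inv hε hw).norm

theorem norm_prodDet_pole_le (hd : 0 < d) (hsep : ∀ m n, m ≠ n → d ≤ |lam m - lam n|) {ε : I → ℂ}
    (hε : Summable fun n => ‖ε n‖) (n : I) :
    ‖prodDet lam ε (lam n)‖ ≤ Real.exp ((∑' m, ‖ε m‖) * d⁻¹) :=
  le_of_tendsto (multipliable_prodDet hε (exists_norm_inv_sub_le hd hsep _)).hasProd.norm
    (Eventually.of_forall fun J =>
      (norm_prod J _).symm.trans_le (norm_prod_poles_le hd hsep hε n J))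

/-- The coefficients of the partial fractions of `prodDet lam ε`. -/
noncomputable def residueSeq (lam : I → ℝ) (ε : I → ℂ) (n : I) : ℂ := ε n * prodDet lam ε (lam n)

theorem summable_norm_residueSeq (hd : 0 < d) (hsep : ∀ m n, m ≠ n → d ≤ |lam m - lam n|)
    {ε : I → ℂ} (hε : Summable fun n => ‖ε n‖) : Summable fun n => ‖residueSeq lam ε n‖ :=
  (hε.mul_right _).of_nonneg_of_le (fun _ => norm_nonneg _) fun n => by
    rw [residueSeq, norm_mul]
    exact mul_le_mul_of_nonneg_left (norm_prodDet_pole_le hd hsep hε n) (norm_nonneg _)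

/-- The expansion of the infinite product into partial fractions. -/
theorem prodDet_eq_pfrac (hd : 0 < d) (hsep : ∀ m n, m ≠ n → d ≤ |lam m - lam n|)
    {ε : I → ℂ} (hε : Summable fun n => ‖ε n‖) {w : ℂ} (hw : ∀ n, (lam n : ℂ) = w → ε n = 0) :
    prodDet lam ε w = pfrac lam (residueSeq lam ε) w := by
  classical
  have hbd := exists_norm_inv_sub_le hd hsep
  have h1 := (multipliable_prodDet hε (hbd w)).hasProd
  obtain ⟨C, hC⟩ := hbd w
  set M := Real.exp ((∑' m, ‖ε m‖) * d⁻¹)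
  let f : Finset I → I → ℂ := fun J n => if n ∈ J then
    ε n * (∏ m ∈ J, (1 + ε m * ((lam m : ℂ) - lam n)⁻¹)) * ((lam n : ℂ) - w)⁻¹ else 0
  -- The finite expansions converge along the directed set of finite subsets, dominated by `‖ε n‖ *
  -- M * C`.
  have h2 : Tendsto (fun J => ∑' n, f J n) atTop
      (𝓝 (∑' n, residueSeq lam ε n * ((lam n : ℂ) - w)⁻¹)) := by
    refine tendsto_tsum_of_dominated_convergence ((hε.mul_right M).mul_right C) (fun n => ?_)
      (Eventually.of_forall fun J n => ?_)
    · have h3 := (((multipliable_prodDet hε (hbd (lam n))).hasProd.const_mul (ε n)).mul_const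
        ((lam n : ℂ) - w)⁻¹)
      refine Tendsto.congr' ?_ h3
      filter_upwards [eventually_ge_atTop {n}] with J hJ
      exact (if_pos (Finset.singleton_subset_iff.1 hJ)).symm
    · have hC0 : 0 ≤ C := (norm_nonneg _).trans (hC n)
      by_cases hn : n ∈ J
      · simp only [f, if_pos hn, norm_mul]
        gcongr
        · exact norm_prod_poles_le hd hsep hε n J
        · exact hC n
      · simp only [f, if_neg hn, norm_zero]
        positivity
  have h3 : ∀ J, 1 + ∑' n, f J n = ∏ n ∈ J, (1 + ε n * ((lam n : ℂ) - w)⁻¹) := fun J => by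
    rw [prod_one_add_eq_sum (injective_of_separated hd hsep) ε J w fun n _ => hw n,
      tsum_eq_sum (s := J) fun n hn => if_neg hn]
    congr 1
    exact Finset.sum_congr rfl fun n hn => if_pos hn
  exact tendsto_nhds_unique h1 ((h2.const_add 1).congr h3)

theorem finite_setOf_add_eq (hd : 0 < d) (hsep : ∀ m n, m ≠ n → d ≤ |lam m - lam n|)
    {ε : I → ℂ} (hε : Summable fun n => ‖ε n‖) (z : ℂ) : {n | (lam n : ℂ) + ε n = z}.Finite := by
  refine (finite_abs_sub_le_of_separated hd hsep z.re (∑' n, ‖ε n‖)).subset fun n hn => ?_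
  have hn' : (lam n : ℂ) + ε n = z := hn
  have h1 : |lam n - z.re| ≤ ‖(lam n : ℂ) - z‖ := by
    simpa using Complex.abs_re_le_norm ((lam n : ℂ) - z)
  rw [← hn', sub_add_cancel_left, norm_neg] at h1
  rw [← hn']
  exact h1.trans (hε.le_tsum n fun _ _ => norm_nonneg _)

theorem eventually_forall_ne (z : ℂ) (hz : ∃ C, ∀ n, ‖((lam n : ℂ) - z)⁻¹‖ ≤ C) :
    ∀ᶠ w in 𝓝[≠] z, ∀ n, (lam n : ℂ) ≠ w := by
  obtain ⟨C, hC⟩ := hz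
  have hK : 0 < max C 1 := lt_max_of_lt_right one_pos
  filter_upwards [mem_nhdsWithin_of_mem_nhds (Metric.ball_mem_nhds z (inv_pos.2 hK)),
    self_mem_nhdsWithin] with w hw hwz n hn
  rw [mem_ball_iff_norm, ← hn] at hw
  have h0 : 0 < ‖(lam n : ℂ) - z‖ := norm_pos_iff.2 (sub_ne_zero.2 (hn ▸ hwz))
  have h1 := (hC n).trans (le_max_left C 1)
  rw [norm_inv, inv_le_comm₀ h0 hK] at h1
  linarith

/-- The zeros of the product are the points `lam n + ε n`, with multiplicities. -/
theorem analyticOrderAt_numer_residueSeq (hd : 0 < d)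
    (hsep : ∀ m n, m ≠ n → d ≤ |lam m - lam n|) {ε : I → ℂ} (hε : Summable fun n => ‖ε n‖) (z : ℂ) :
    analyticOrderAt (numer lam (residueSeq lam ε) z) z = {n | (lam n : ℂ) + ε n = z}.encard := by
  classical
  have hinj := injective_of_separated hd hsep
  have hbd := exists_norm_inv_sub_le hd hsep
  have hres := summable_norm_residueSeq hd hsep hε
  have hfin1 := finite_setOf_add_eq hd hsep hε z
  have hfin2 : {n | (lam n : ℂ) = z}.Finite := by
    simpa using finite_setOf_add_eq hd hsep (ε := 0) (by simp) z
  -- `J` collects all factors with a zero or a pole at `z`. The product of the others, encoded by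
  -- `ε'`, is analytic and nonzero at `z`.
  set J : Finset I := hfin1.toFinset ∪ hfin2.toFinset with hJ
  have hJ1 : ∀ n, (lam n : ℂ) + ε n = z → n ∈ J := fun n hn => by simp [hJ, hn]
  have hJ2 : ∀ n, (lam n : ℂ) = z → n ∈ J := fun n hn => by simp [hJ, hn]
  set ε' : I → ℂ := fun n => if n ∈ J then 0 else ε n with hε'
  have hε's : Summable fun n => ‖ε' n‖ := hε.of_nonneg_of_le (fun _ => norm_nonneg _) fun n => by
    simp only [hε']
    split_ifs <;> simp
  have hres' := summable_norm_residueSeq hd hsep hε's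
  have hε'z : ∀ n, (lam n : ℂ) = z → ε' n = 0 := fun n hn => if_pos (hJ2 n hn)
  have hana : AnalyticAt ℂ (pfrac lam (residueSeq lam ε')) z :=
    analyticAt_pfrac hres' (hbd z) fun n hn => by rw [residueSeq, hε'z n hn, zero_mul]
  have hne0 : pfrac lam (residueSeq lam ε') z ≠ 0 := by
    rw [← prodDet_eq_pfrac hd hsep hε's hε'z]
    refine tprod_one_add_ne_zero_of_summable (fun n => ?_) (summable_mul_inv hε's (hbd z)).norm
    by_cases hn : n ∈ J
    · simp [hε', hn]
    · have h1 : (lam n : ℂ) - z ≠ 0 := sub_ne_zero.2 fun h => hn (hJ2 n h)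
      have h2 : (lam n : ℂ) + ε n - z ≠ 0 := sub_ne_zero.2 fun h => hn (hJ1 n h)
      have h3 : 1 + ε n * ((lam n : ℂ) - z)⁻¹ = ((lam n : ℂ) + ε n - z) * ((lam n : ℂ) - z)⁻¹ := by
        field_simp
        ring
      simp only [hε', if_neg hn, h3]
      exact mul_ne_zero h2 (inv_ne_zero h1)
  have hprod : ∀ w, prodDet lam ε w = (∏ n ∈ J, (1 + ε n * ((lam n : ℂ) - w)⁻¹)) *
      prodDet lam ε' w := fun w => by
    have h1 := multipliable_prodDet hε's (hbd w)
    have h2 : HasProd (fun n => if n ∈ J then 1 + ε n * ((lam n : ℂ) - w)⁻¹ else 1)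
        (∏ n ∈ J, (1 + ε n * ((lam n : ℂ) - w)⁻¹)) := by
      have := hasProd_prod_of_ne_finset_one (s := J) (L := SummationFilter.unconditional I)
        (f := fun n => if n ∈ J then 1 + ε n * ((lam n : ℂ) - w)⁻¹ else 1) fun n hn => if_neg hn
      rwa [Finset.prod_congr rfl fun n hn => if_pos hn] at this
    refine HasProd.tprod_eq ((h2.mul h1.hasProd).congr_fun fun n => ?_)
    by_cases hn : n ∈ J <;> simp [hε', hn]
  -- The factor with index `n` without its zero or pole at `z`; the values `-1` come from `z - w =
  -- -(w - z)`.
  let u : I → ℂ → ℂ := fun n w => (if (lam n : ℂ) + ε n = z then -1 else (lam n : ℂ) + ε n - w) *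
    (if (lam n : ℂ) = z then -1 else ((lam n : ℂ) - w)⁻¹)
  have hu : ∀ n, AnalyticAt ℂ (u n) z := fun n => by
    have h1 : AnalyticAt ℂ (fun w => if (lam n : ℂ) + ε n = z then (-1 : ℂ) else
        (lam n : ℂ) + ε n - w) z := by
      split_ifs <;> fun_prop
    have h2 : AnalyticAt ℂ (fun w => if (lam n : ℂ) = z then (-1 : ℂ) else
        ((lam n : ℂ) - w)⁻¹) z := by
      split_ifs with h
      · fun_prop
      · exact (analyticAt_const.sub analyticAt_id).inv (sub_ne_zero.2 h)
    exact h1.mul h2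
  have hu0 : ∀ n, u n z ≠ 0 := fun n => by
    refine mul_ne_zero ?_ ?_
    · split_ifs with h
      · simp
      · exact sub_ne_zero.2 h
    · split_ifs with h
      · simp
      · exact inv_ne_zero (sub_ne_zero.2 h)
  have hpow1 : ∀ w : ℂ, ∏ n ∈ J, (if (lam n : ℂ) + ε n = z then w else 1) =
      w ^ hfin1.toFinset.card := fun w => by
    rw [← Finset.prod_filter, Finset.prod_const]
    congr 2
    ext n
    simpa using hJ1 n
  have hpow2 : ∀ w : ℂ, ∏ n ∈ J, (if (lam n : ℂ) = z then w else 1) =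
      w ^ poleOrder lam z := fun w => by
    by_cases h : ∃ m, (lam m : ℂ) = z
    · obtain ⟨m, hm⟩ := h
      rw [Finset.prod_eq_single_of_mem m (hJ2 m hm) fun n _ hn => if_neg fun h =>
        hn (hinj (by exact_mod_cast h.trans hm.symm)), if_pos hm, poleOrder, if_pos ⟨m, hm⟩, pow_one]
    · rw [poleOrder, if_neg h, pow_zero]
      push Not at h
      exact Finset.prod_eq_one fun n _ => if_neg (h n)
  have hev : ∀ᶠ w in 𝓝[≠] z, numer lam (residueSeq lam ε) z w =
      (w - z) ^ hfin1.toFinset.card * ((∏ n ∈ J, u n w) * pfrac lam (residueSeq lam ε') w) := by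
    filter_upwards [eventually_forall_ne z (hbd z), self_mem_nhdsWithin] with w hw hwz
    have hwz' : w - z ≠ 0 := sub_ne_zero.2 hwz
    rw [numer_eq_pow_mul hinj hres z (hbd w) hwz,
      ← prodDet_eq_pfrac hd hsep hε fun n hn => absurd hn (hw n), hprod,
      prodDet_eq_pfrac hd hsep hε's fun n hn => absurd hn (hw n), ← mul_assoc, ← mul_assoc,
      ← hpow1, ← hpow2, ← Finset.prod_mul_distrib, ← Finset.prod_mul_distrib]
    congr 1
    refine Finset.prod_congr rfl fun n _ => ?_
    have h1 : (lam n : ℂ) - w ≠ 0 := sub_ne_zero.2 (hw n)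
    have h3 : 1 + ε n * ((lam n : ℂ) - w)⁻¹ = ((lam n : ℂ) + ε n - w) * ((lam n : ℂ) - w)⁻¹ := by
      field_simp
      ring
    rw [h3]
    simp only [u]
    have h4 : (if (lam n : ℂ) + ε n = z then w - z else 1) *
        (if (lam n : ℂ) + ε n = z then -1 else (lam n : ℂ) + ε n - w) = (lam n : ℂ) + ε n - w := by
      split_ifs with h
      · rw [h]; ring
      · ring
    have h5 : (if (lam n : ℂ) = z then (-1 : ℂ) else ((lam n : ℂ) - w)⁻¹) =
        (if (lam n : ℂ) = z then w - z else 1) * ((lam n : ℂ) - w)⁻¹ := by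
      split_ifs with h
      · rw [h, ← neg_sub w z, inv_neg]
        field_simp
      · ring
    rw [h5]
    linear_combination -((if (lam n : ℂ) = z then w - z else 1) * ((lam n : ℂ) - w)⁻¹) * h4
  have hana2 : AnalyticAt ℂ (fun w => (∏ n ∈ J, u n w) * pfrac lam (residueSeq lam ε') w) z :=
    (Finset.analyticAt_fun_prod J fun n _ => hu n).mul hana
  have hana3 : AnalyticAt ℂ (fun w => (w - z) ^ hfin1.toFinset.card *
      ((∏ n ∈ J, u n w) * pfrac lam (residueSeq lam ε') w)) z :=
    ((analyticAt_id.sub analyticAt_const).pow _).mul hana2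
  have hev' := ((analyticAt_numer hres (hbd z)).frequently_eq_iff_eventually_eq hana3).1
    hev.frequently
  have horder : analyticOrderAt (numer lam (residueSeq lam ε) z) z =
      (hfin1.toFinset.card : ℕ∞) := by
    rw [(analyticAt_numer hres (hbd z)).analyticOrderAt_eq_natCast]
    exact ⟨_, hana2, mul_ne_zero (Finset.prod_ne_zero_iff.2 fun n _ => hu0 n) hne0, hev'⟩
  rw [horder, ← Set.encard_coe_eq_coe_finsetCard, hfin1.coe_toFinset]

/-- The inverse spectral problem for rank one perturbations: the perturbed operator has given
eigenvalues if and only if the products of the Fourier coefficients have given values. -/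
theorem hasEigenvalues_perturb_iff {H : Type*} [NormedAddCommGroup H] [InnerProductSpace ℂ H]
    {A : H →ₗ.[ℂ] H} {b : HilbertBasis I ℂ H} (hd : 0 < d)
    (hsep : ∀ m n, m ≠ n → d ≤ |lam m - lam n|) (hA : IsDiagonal A b lam) {ε : I → ℂ}
    (hε : Summable fun n => ‖ε n‖) (φ ψ : H) :
    HasEigenvalues (perturb A φ ψ) (fun n => (lam n : ℂ) + ε n) ↔
      ∀ n, coeffProd b φ ψ n = residueSeq lam ε n := by
  have hinj := injective_of_separated hd hsep
  have hbd := exists_norm_inv_sub_le hd hsep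
  simp only [HasEigenvalues, algMult_perturb hinj hA (hbd _),
    ← analyticOrderAt_numer_residueSeq hd hsep hε]
  constructor
  · intro h n
    refine congrFun (eq_of_analyticOrderAt_numer_eq hd hsep (summable_norm_coeffProd b φ ψ)
      (summable_norm_residueSeq hd hsep hε) h fun z => ?_) n
    rw [analyticOrderAt_numer_residueSeq hd hsep hε]
    exact (finite_setOf_add_eq hd hsep hε z).encard_lt_top.ne
  · intro h z
    rw [funext h]

end InfiniteProduct

end RankOnePert

namespace RankOnePert

/-! ### The affine space of solutions. -/

section SolutionSet

variable {H : Type*} [NormedAddCommGroup H] [InnerProductSpace ℂ H] {I : Type*}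

/-- The vectors whose Fourier coefficients outside of `Z` vanish. -/
def vanishingOutside (v : I → H) (Z : Set I) : Submodule ℂ H where
  carrier := {x | ∀ n, n ∉ Z → coeff v x n = 0}
  add_mem' := fun hx hy n hn => by rw [coeff_add, hx n hn, hy n hn, add_zero]
  zero_mem' := fun _ _ => inner_zero_right _
  smul_mem' := fun a x hx n hn => by rw [coeff_smul, hx n hn, mul_zero]

theorem mem_vanishingOutside {v : I → H} {Z : Set I} {x : H} :
    x ∈ vanishingOutside v Z ↔ ∀ n, n ∉ Z → coeff v x n = 0 := Iff.rfl

/-- The `b n` with `n ∈ Z` are independent, which gives one inequality. For finite `Z` the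
coefficients embed the space into `Z → ℂ`; for infinite `Z` the other bound is trivial in `ℕ∞`. -/
theorem toENat_rank_vanishingOutside (b : HilbertBasis I ℂ H) (Z : Set I) :
    Cardinal.toENat (Module.rank ℂ (vanishingOutside b Z)) = Z.encard := by
  have hmem : ∀ n : Z, b n ∈ vanishingOutside b Z := fun n m hm =>
    coeff_basis_of_ne b fun h => hm (h ▸ n.2)
  have hli : LinearIndependent ℂ fun n : Z => (⟨b n, hmem n⟩ : vanishingOutside b Z) := by
    refine LinearIndependent.of_comp (vanishingOutside b Z).subtype ?_
    exact b.orthonormal.linearIndependent.comp _ Subtype.val_injective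
  have h1 : Z.encard ≤ Cardinal.toENat (Module.rank ℂ (vanishingOutside b Z)) := by
    have := OrderHomClass.mono Cardinal.toENat hli.cardinal_lift_le_rank
    rwa [Cardinal.toENat_lift, Cardinal.toENat_lift, Set.toENat_cardinalMk] at this
  refine le_antisymm ?_ h1
  rcases Z.finite_or_infinite with hZ | hZ
  · have := hZ.fintype
    let f : vanishingOutside b Z →ₗ[ℂ] (Z → ℂ) :=
      { toFun := fun x n => coeff b x n
        map_add' := fun x y => funext fun n => coeff_add _ _ _ _
        map_smul' := fun a x => funext fun n => coeff_smul _ _ _ _ }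
    have hf : Function.Injective f := fun x y hxy => Subtype.ext <| coeff_ext b fun n => by
      by_cases hn : n ∈ Z
      · exact congrFun hxy ⟨n, hn⟩
      · rw [x.2 n hn, y.2 n hn]
    have h2 := OrderHomClass.mono Cardinal.toENat (LinearMap.lift_rank_le_of_injective f hf)
    rwa [Cardinal.toENat_lift, Cardinal.toENat_lift, rank_fun', ← Cardinal.mk_fintype,
      Set.toENat_cardinalMk] at h2
  · rw [hZ.encard_eq]
    exact le_top

/-- The set of vectors for which the Fourier coefficients with `k n ≠ 0` are prescribed. -/
theorem solutionSet_properties (b : HilbertBasis I ℂ H) {k y : I → ℂ} (hy : Memℓp y 2) {S : Set H}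
    (hS : ∀ x, x ∈ S ↔ ∀ n, coeff b x n * k n = y n * k n) :
    S.Nonempty ∧ ((∃! x, x ∈ S) ↔ ∀ n, k n ≠ 0) ∧
      (∀ x₀ ∈ S, ∀ x, x ∈ S ↔ ∀ n, k n ≠ 0 → coeff b x n = coeff b x₀ n) ∧
      ∃ E : AffineSubspace ℂ H, (E : Set H) = S ∧
        Cardinal.toENat (Module.rank ℂ E.direction) = {n | k n = 0}.encard := by
  have hx₀ : ofCoeff b y hy ∈ S := (hS _).2 fun n => by rw [coeff_ofCoeff]
  have hmem : ∀ x₀ ∈ S, ∀ x, x ∈ S ↔ ∀ n, k n ≠ 0 → coeff b x n = coeff b x₀ n := by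
    intro x₀ h₀ x
    rw [hS] at h₀ ⊢
    refine forall_congr' fun n => ?_
    rw [← h₀ n, mul_eq_mul_right_iff]
    tauto
  refine ⟨⟨_, hx₀⟩, ⟨?_, fun h => ⟨_, hx₀, fun x hx => coeff_ext b fun n => ?_⟩⟩, hmem, ?_⟩
  · rintro ⟨x, hx, huniq⟩ n hn
    -- If `k n = 0`, moving along `b n` gives a second solution.
    have h1 : x + b n ∈ S := (hmem x hx _).2 fun m hm => by
      rw [coeff_add, coeff_basis_of_ne b (m := n) (n := m) (by rintro rfl; exact hm hn),
        add_zero]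
    have h2 : b n = 0 := by simpa using huniq _ h1
    have h3 := b.orthonormal.1 n
    rw [h2, norm_zero] at h3
    exact zero_ne_one h3
  · exact (hmem _ hx₀ x).1 hx n (h n)
  · refine ⟨AffineSubspace.mk' (ofCoeff b y hy) (vanishingOutside b {n | k n = 0}), ?_, ?_⟩
    · ext x
      rw [SetLike.mem_coe, AffineSubspace.mem_mk', vsub_eq_sub, mem_vanishingOutside,
        hmem _ hx₀ x]
      refine forall_congr' fun n => ?_
      rw [coeff_sub, sub_eq_zero]
      rfl
    · rw [AffineSubspace.direction_mk', toENat_rank_vanishingOutside]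

theorem summable_norm_of_mem_ellOne (b : HilbertBasis I ℂ H) {f : H} {x ε : I → ℂ}
    (hx : Memℓp x 2) (hε : ∀ n, ε n = x n * coeff b f n) : Summable fun n => ‖ε n‖ := by
  have h : (ENNReal.toReal 2).HolderConjugate (ENNReal.toReal 2) := by
    rw [ENNReal.toReal_ofNat]
    exact Real.HolderConjugate.two_two
  have := lp.summable_mul h (⟨x, hx⟩ : lp (fun _ : I => ℂ) 2) ⟨_, memℓp_coeff b f⟩
  refine this.congr fun n => ?_
  rw [hε, norm_mul]

theorem inner_basis_eq_conj_coeff (v : I → H) (f : H) (n : I) :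
    inner ℂ f (v n) = starRingEnd ℂ (coeff v f n) := (inner_conj_symm _ _).symm

end SolutionSet

end RankOnePert

/-! ### The inverse problem for either vector. -/

open RankOnePert in
theorem corollary5p3 {H : Type*} [NormedAddCommGroup H] [InnerProductSpace ℂ H] [CompleteSpace H]
    (A : H →ₗ.[ℂ] H) (hA : IsSelfAdjoint A) (hdisc : SimpleDiscreteSpectrum A)
    {I : Type*} (lam : I → ℝ)
    (hlam : spec A = Set.range (fun n => (lam n : ℂ)))
    (hsep : ∃ d > 0, ∀ m n, m ≠ n → d ≤ |lam m - lam n|)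
    (v : I → H) (hv : ∀ n, ‖v n‖ = 1) (hAv : ∀ n, v n ∈ eigenspace A (lam n)) :
    (∀ φ : H, ∀ ε ∈ ellOne v φ, ∀ S : Set H,
      S = {ψ : H | HasEigenvalues (perturb A φ ψ) (fun n => (lam n : ℂ) + ε n)} →
        S.Nonempty ∧
        ((∃! ψ, ψ ∈ S) ↔ ∀ n, coeff v φ n ≠ 0) ∧
        (∀ ψ₀ ∈ S, ∀ ψ, ψ ∈ S ↔ ∀ n, coeff v φ n ≠ 0 → coeff v ψ n = coeff v ψ₀ n) ∧
        ∃ E : AffineSubspace ℂ H, (E : Set H) = S ∧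
          Cardinal.toENat (Module.rank ℂ E.direction) = {n | coeff v φ n = 0}.encard) ∧
    (∀ ψ : H, ∀ ε ∈ ellOne v ψ, ∀ S : Set H,
      S = {φ : H | HasEigenvalues (perturb A φ ψ) (fun n => (lam n : ℂ) + ε n)} →
        S.Nonempty ∧
        ((∃! φ, φ ∈ S) ↔ ∀ n, coeff v ψ n ≠ 0) ∧
        (∀ φ₀ ∈ S, ∀ φ, φ ∈ S ↔ ∀ n, coeff v ψ n ≠ 0 → coeff v φ n = coeff v φ₀ n) ∧
        ∃ E : AffineSubspace ℂ H, (E : Set H) = S ∧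
          Cardinal.toENat (Module.rank ℂ E.direction) = {n | coeff v ψ n = 0}.encard) := by
  obtain ⟨d, hd, hsep⟩ := hsep
  obtain ⟨b, rfl, hdiag⟩ := exists_isDiagonal hA hdisc hlam hd hsep hv hAv
  have hbdd : ∀ {f : H} {x ε : I → ℂ}, Memℓp x 2 → (∀ n, ε n = x n * coeff b f n) →
      Memℓp (fun n => prodDet lam ε (lam n) * x n) 2 := fun hx hε =>
    memℓp_mul_of_bounded ⟨_, norm_prodDet_pole_le hd hsep (summable_norm_of_mem_ellOne b hx hε)⟩ hx
  refine ⟨?_, ?_⟩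
  · rintro φ ε ⟨x, hx, hε⟩ S rfl
    have hεs := summable_norm_of_mem_ellOne b hx hε
    -- The equation contains `conj (a n)`, whereas `ε n = x n * a n`. The factor `a n / conj (a n)`
    -- corrects this; it has modulus 1, or is `0 / 0 = 0` where `a n = 0`.
    have hy : Memℓp (fun n => coeff b φ n / starRingEnd ℂ (coeff b φ n) *
        (prodDet lam ε (lam n) * x n)) 2 := by
      refine memℓp_mul_of_bounded ⟨1, fun n => ?_⟩ (hbdd hx hε)
      rw [norm_div, RCLike.norm_conj]
      exact div_self_le_one _
    have := solutionSet_properties b (k := fun n => starRingEnd ℂ (coeff b φ n)) hy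
      (S := {ψ : H | HasEigenvalues (perturb A φ ψ) (fun n => (lam n : ℂ) + ε n)}) fun ψ => by
        refine (hasEigenvalues_perturb_iff hd hsep hdiag hεs φ ψ).trans (forall_congr' fun n => ?_)
        rw [coeffProd, inner_basis_eq_conj_coeff, residueSeq, hε n]
        refine Eq.congr_right ?_
        by_cases h : coeff b φ n = 0
        · simp [h]
        · have : starRingEnd ℂ (coeff b φ n) ≠ 0 := by simpa using h
          field_simp
    simpa only [ne_eq, map_eq_zero] using this
  · rintro ψ ε ⟨x, hx, hε⟩ S rfl
    have hεs := summable_norm_of_mem_ellOne b hx hε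
    -- Here the unknown enters conjugated, so the whole equation is conjugated and no phase factor
    -- is needed.
    have hy : Memℓp (fun n => starRingEnd ℂ (prodDet lam ε (lam n) * x n)) 2 :=
      (hbdd hx hε).mono' fun n => (RCLike.norm_conj _).le
    have := solutionSet_properties b (k := fun n => starRingEnd ℂ (coeff b ψ n)) hy
      (S := {φ : H | HasEigenvalues (perturb A φ ψ) (fun n => (lam n : ℂ) + ε n)}) fun φ => by
        refine (hasEigenvalues_perturb_iff hd hsep hdiag hεs φ ψ).trans (forall_congr' fun n => ?_)
        rw [coeffProd, inner_basis_eq_conj_coeff, residueSeq, hε n,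
          ← (starRingEnd ℂ).injective.eq_iff]
        simp only [map_mul, Complex.conj_conj]
        rw [mul_comm (starRingEnd ℂ (coeff b ψ n))]
        refine Eq.congr_right ?_
        ring
    simpa only [ne_eq, map_eq_zero] using this
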